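/- Let $\lambda,\mu>0$, $\xi\ge 0$ and $\alpha\in(0,1]$. Let $\{X^\alpha_t\}_{t\ge 0}$ be a fractional $M/M/1$ queue with catastrophes of parameter $\alpha$, with arrival rate $\lambda$, service rate $\mu$ and catastrophe rate $\xi$; that is, an $\mathbb{N}_0$-valued process whose transition probabilities $P^\alpha_{i,n}(t)=P(X^\alpha_t=n\mid X^\alpha_0=i)$ are continuous in $t\ge0$, satisfy $P^\alpha_{i,n}(0)=\delta_{i,n}$ and, for $t>0$, $$D^\alpha_tP^\alpha_{i,0}=-(\lambda+\xi)P^\alpha_{i,0}+\mu P^\alpha_{i,1}+\xi,\qquad D^\alpha_tP^\alpha_{i,n}=-(\lambda+\mu+\xi)P^\alpha_{i,n}+\lambda P^\alpha_{i,n-1}+\mu P^\alpha_{i,n+1}\quad(n\ge 1),$$ where $D^\alpha_t$ is the Caputo derivative of order $\alpha$, $D^\alpha_tf=\frac{d}{dt}J^{1-\alpha}(f-f(0))$, with $J^\beta f(t)=\frac1{\Gamma(\beta)}\int_0^t(t-s)^{\beta-1}f(s)\,ds$ for $\beta>0$ and $J^0f=f$ (so $D^1_t=d/dt$). Let $$E^\delta_{\beta,\gamma}(w)=\sum_{r=0}^\infty\frac{w^r\,\Gamma(\delta+r)}{r!\,\Gamma(\beta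 r+\gamma)\,\Gamma(\delta)}$$ be the three-parameter Mittag-Leffler function, and let $(f\ast g)(t)=\int_0^tf(u)g(t-u)\,du$. Then for every initial state $i$ (with $P(X^\alpha_0=i)>0$) and every $t\ge0$, conditionally on $X^\alpha_0=i$, the variable $X^\alpha_t$ has a finite second moment and, if $\xi>0$, $$\begin{aligned}\mathrm{Var}(X^\alpha_t)={}&i^2E^1_{\alpha,1}(-\xi t^\alpha)+2it^\alpha(\lambda-\mu)E^2_{\alpha,\alpha+1}(-\xi t^\alpha)-\mu\,[P^\alpha_{i,0}(t)\ast t^{\alpha-1}E^1_{\alpha,\alpha}(-\xi t^\alpha)]\\&+2\mu(\lambda-\mu)\,[P^\alpha_{i,0}(t)\ast t^{2\alpha-1}E^2_{\alpha,2\alpha}(-\xi t^\alpha)]+(\mu+\lambda)t^\alpha E^1_{\alpha,\alpha+1}(-\xi t^\alpha)+2t^{2\alpha}(\lambda-\mu)^2E^2_{\alpha,2\alpha+1}(-\xi t^\alpha)\\&-\Big[iE^1_{\alpha,1}(-\xi t^\alpha)+\mu\,P^\alpha_{i,0}(t)\ast t^{\alpha-1}E^1_{\alpha,\alpha}(-\xi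 t^\alpha)+\frac{\lambda-\mu}{\xi}\big(1-E^1_{\alpha,1}(-\xi t^\alpha)\big)\Big]^2.\end{aligned}$$ Moreover, for every $\xi\ge0$ (including $\xi=0$) the same formula holds with $\frac{\lambda-\mu}{\xi}\big(1-E^1_{\alpha,1}(-\xi t^\alpha)\big)$ replaced by $(\lambda-\mu)t^\alpha E^1_{\alpha,\alpha+1}(-\xi t^\alpha)$. -/

import Mathlib

open MeasureTheory ProbabilityTheory Set
open scoped NNReal

noncomputable section

/-- The three-parameter (Prabhakar) Mittag-Leffler function
`E^δ_{β,γ}(w) = ∑_{r ≥ 0} Γ(δ+r) w^r / (r! Γ(βr+γ) Γ(δ))`, for real parameters and argument. -/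
def mittagLeffler (δ β γ w : ℝ) : ℝ :=
  ∑' r : ℕ, w ^ r * Real.Gamma (δ + r) /
    ((Nat.factorial r : ℝ) * Real.Gamma (β * r + γ) * Real.Gamma δ)

/-- The convolution `(f ∗ g)(t) = ∫₀ᵗ f(u) g(t - u) du` of functions of time. -/
def timeConv (f g : ℝ → ℝ) (t : ℝ) : ℝ :=
  ∫ u in (0 : ℝ)..t, f u * g (t - u)

/-- The Riemann-Liouville fractional integral of order `β ≥ 0` based at `0`:
`(J^β f)(t) = Γ(β)⁻¹ ∫₀ᵗ (t - s)^(β-1) f(s) ds` for `β > 0`, and `J^0 f = f`. -/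
def fracIntegral (β : ℝ) (f : ℝ → ℝ) (t : ℝ) : ℝ :=
  if β = 0 then f t
  else (Real.Gamma β)⁻¹ * ∫ s in (0 : ℝ)..t, (t - s) ^ (β - 1) * f s

/-- `f` has at time `t` the Caputo derivative `d` of order `α ∈ (0,1]` (based at `0`):
`d = d/dt J^{1-α}(f - f(0))`, the derivative being required to exist. For absolutely continuous
`f` and `α < 1` this agrees a.e. with `Γ(1-α)⁻¹ ∫₀ᵗ (t - s)^(-α) f'(s) ds`; for `α = 1` it is `f'(t)`. -/
def HasCaputoDerivAt (α : ℝ) (f : ℝ → ℝ) (d t : ℝ) : Prop :=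
  HasDerivAt (fracIntegral (1 - α) (fun s => f s - f 0)) d t

/-- `transitionProb P X i n t = P(X_t = n | X_0 = i)`, for real `t ≥ 0`. -/
def transitionProb {Ω : Type*} [MeasurableSpace Ω] (P : Measure Ω) (X : ℝ≥0 → Ω → ℕ)
    (i n : ℕ) (t : ℝ) : ℝ :=
  (cond P (X 0 ⁻¹' {i})).real (X t.toNNReal ⁻¹' {n})

/-- `X` is a fractional M/M/1 queue with catastrophes of parameter `α ∈ (0,1]`, with arrival rate
`lam`, service rate `μ` and catastrophe rate `ξ`: for each state `i` in which the process can
start, the transition probabilities out of `i` are continuous in time and satisfy the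
fractional Kolmogorov forward equations. For `α = 1` these are the ordinary ones. -/
structure IsFractionalQueue {Ω : Type*} [MeasurableSpace Ω] (P : Measure Ω)
    (α lam μ ξ : ℝ) (X : ℝ≥0 → Ω → ℕ) : Prop where
  measurable : ∀ t, Measurable (X t)
  continuousOn : ∀ i n, P (X 0 ⁻¹' {i}) ≠ 0 →
    ContinuousOn (transitionProb P X i n) (Ici 0)
  init : ∀ i n, P (X 0 ⁻¹' {i}) ≠ 0 →
    transitionProb P X i n 0 = if i = n then 1 else 0
  forward_zero : ∀ i, P (X 0 ⁻¹' {i}) ≠ 0 → ∀ t : ℝ, 0 < t →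
    HasCaputoDerivAt α (transitionProb P X i 0)
      (-(lam + ξ) * transitionProb P X i 0 t + μ * transitionProb P X i 1 t + ξ) t
  forward_pos : ∀ i n, 1 ≤ n → P (X 0 ⁻¹' {i}) ≠ 0 → ∀ t : ℝ, 0 < t →
    HasCaputoDerivAt α (transitionProb P X i n)
      (-(lam + μ + ξ) * transitionProb P X i n t + lam * transitionProb P X i (n - 1) t
        + μ * transitionProb P X i (n + 1) t) t

/-- `(P_{i,0} ∗ [s^{δα-1} E^δ_{α,δα}(-ξ s^α)])(t)`, where `p0 = P_{i,0}`. -/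
def mlConv (α ξ δ : ℝ) (p0 : ℝ → ℝ) (t : ℝ) : ℝ :=
  timeConv p0 (fun s => s ^ (δ * α - 1) * mittagLeffler δ α (δ * α) (-ξ * s ^ α)) t

end

/-! Write J^α for the fractional integral. Applying J^α turns the Caputo forward equations into
Volterra equations `p_n = δ_{i,n} + J^α (rate_n)` (`eq_add_fracIntegral_of_hasCaputoDerivAt`).
Pairing them with an eventually constant φ involves only finitely many states, and summation by
parts gives a fractional Dynkin formula E φ(X_t) = φ(i) + J^α(E Gφ(X))(t), where G is the generator
of the queue.

Moments are not assumed finite. For φ = min(n, N)^2, services and catastrophes only decrease φ, so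
Gφ ≤ λ + 2λφ. A fractional Grönwall inequality bounds E φ(X_t) uniformly in N and in t ≤ T, and
Fatou's lemma gives the second moment. Dominated convergence then extends Dynkin's formula to φ of
quadratic growth (`SolvesForward.stateMean_eq_add_fracIntegral`).

Since G n = λ - μ + μ 1_{n=0} - ξ n and G n² = λ + μ - μ 1_{n=0} + 2(λ - μ) n - ξ n², the first two
moments satisfy a triangular linear system of fractional integral equations with P_{i,0} as a
source. Iterating it gives Neumann series (`eq_tsum_of_eq_add_fracIntegral`): the resolvent (1 + ξ
J^α)^{-1} produces the functions E^1, and its square, coming from the coupling, produces E^2.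
Convergence rests on Γ(αk + γ) outgrowing every geometric sequence. Applied to constants the series
are Mittag-Leffler functions; applied to P_{i,0} they are the convolutions. The variance is the
second moment minus the squared mean. -/

/-! ### Riemann-Liouville integrals of measurable, locally bounded functions. -/

/-- Measurable functions of time that are bounded on every interval `[0, T]`. -/
structure MeasurableLocallyBounded (f : ℝ → ℝ) : Prop where
  measurable : Measurable f
  bounded : ∀ T : ℝ, ∃ C : ℝ, 0 ≤ C ∧ ∀ s ∈ Icc 0 T, |f s| ≤ C

namespace MeasurableLocallyBounded

theorem const (c : ℝ) : MeasurableLocallyBounded (fun _ => c) :=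
  ⟨measurable_const, fun _ => ⟨|c|, abs_nonneg c, fun _ _ => le_rfl⟩⟩

theorem add {f g : ℝ → ℝ} (hf : MeasurableLocallyBounded f) (hg : MeasurableLocallyBounded g) :
    MeasurableLocallyBounded (fun s => f s + g s) := by
  refine ⟨hf.measurable.add hg.measurable, fun T => ?_⟩
  obtain ⟨C, hC, hfC⟩ := hf.bounded T
  obtain ⟨D, hD, hgD⟩ := hg.bounded T
  exact ⟨C + D, add_nonneg hC hD, fun s hs =>
    (abs_add_le _ _).trans (add_le_add (hfC s hs) (hgD s hs))⟩

theorem const_mul {f : ℝ → ℝ} (c : ℝ) (hf : MeasurableLocallyBounded f) :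
    MeasurableLocallyBounded (fun s => c * f s) := by
  refine ⟨hf.measurable.const_mul c, fun T => ?_⟩
  obtain ⟨C, hC, hfC⟩ := hf.bounded T
  refine ⟨|c| * C, by positivity, fun s hs => ?_⟩
  rw [abs_mul]
  exact mul_le_mul_of_nonneg_left (hfC s hs) (abs_nonneg c)

theorem of_continuous {f : ℝ → ℝ} (hf : Continuous f) : MeasurableLocallyBounded f := by
  refine ⟨hf.measurable, fun T => ?_⟩
  obtain ⟨C, hC⟩ := (isCompact_Icc (a := (0 : ℝ)) (b := T)).exists_bound_of_continuousOn
    hf.continuousOn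
  exact ⟨max C 0, le_max_right _ _, fun s hs => (hC s hs).trans (le_max_left _ _)⟩

end MeasurableLocallyBounded

theorem intervalIntegrable_sub_rpow {β : ℝ} (hβ : 0 < β) (t : ℝ) :
    IntervalIntegrable (fun s : ℝ => (t - s) ^ (β - 1)) volume 0 t := by
  have h := (intervalIntegral.intervalIntegrable_rpow' (a := 0) (b := t)
    (r := β - 1) (by linarith)).comp_sub_left t
  simpa using h.symm

theorem integral_sub_rpow {β : ℝ} (hβ : 0 < β) (t : ℝ) :
    ∫ s in (0 : ℝ)..t, (t - s) ^ (β - 1) = t ^ β / β := by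
  rw [intervalIntegral.integral_comp_sub_left (fun x : ℝ => x ^ (β - 1)) t,
    integral_rpow (Or.inl (by linarith))]
  simp [Real.zero_rpow hβ.ne']

namespace MeasurableLocallyBounded

theorem intervalIntegrable_rpow_mul {f : ℝ → ℝ} (hf : MeasurableLocallyBounded f) {β : ℝ}
    (hβ : 0 < β) {t : ℝ} (ht : 0 ≤ t) :
    IntervalIntegrable (fun s : ℝ => (t - s) ^ (β - 1) * f s) volume 0 t := by
  obtain ⟨C, hC, hfC⟩ := hf.bounded t
  rw [intervalIntegrable_iff_integrableOn_Ioc_of_le ht]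
  refine Integrable.mul_bdd (c := C) ?_ hf.measurable.aestronglyMeasurable ?_
  · exact (intervalIntegrable_iff_integrableOn_Ioc_of_le ht).1 (intervalIntegrable_sub_rpow hβ t)
  · filter_upwards [ae_restrict_mem measurableSet_Ioc] with s hs
    exact hfC s ⟨hs.1.le, hs.2⟩

end MeasurableLocallyBounded

theorem fracIntegral_zero (f : ℝ → ℝ) : fracIntegral 0 f = f := by
  funext t
  simp [fracIntegral]

theorem fracIntegral_of_pos {β : ℝ} (hβ : 0 < β) (f : ℝ → ℝ) (t : ℝ) :
    fracIntegral β f t = (Real.Gamma β)⁻¹ * ∫ s in (0 : ℝ)..t, (t - s) ^ (β - 1) * f s := by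
  rw [fracIntegral, if_neg hβ.ne']

theorem fracIntegral_one (f : ℝ → ℝ) (t : ℝ) :
    fracIntegral 1 f t = ∫ s in (0 : ℝ)..t, f s := by
  simp [fracIntegral]

theorem fracIntegral_const_mul (β c : ℝ) (f : ℝ → ℝ) (t : ℝ) :
    fracIntegral β (fun s => c * f s) t = c * fracIntegral β f t := by
  unfold fracIntegral
  split_ifs
  · rfl
  · have : ∀ s : ℝ, (t - s) ^ (β - 1) * (c * f s) = c * ((t - s) ^ (β - 1) * f s) :=
      fun s => by ring
    simp_rw [this, intervalIntegral.integral_const_mul]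
    ring

theorem fracIntegral_add {f g : ℝ → ℝ} (hf : MeasurableLocallyBounded f)
    (hg : MeasurableLocallyBounded g) {β : ℝ} (hβ : 0 ≤ β) {t : ℝ} (ht : 0 ≤ t) :
    fracIntegral β (fun s => f s + g s) t = fracIntegral β f t + fracIntegral β g t := by
  rcases hβ.eq_or_lt with rfl | hβ
  · simp [fracIntegral_zero]
  · simp_rw [fracIntegral_of_pos hβ, mul_add]
    rw [intervalIntegral.integral_add (hf.intervalIntegrable_rpow_mul hβ ht)
      (hg.intervalIntegrable_rpow_mul hβ ht), mul_add]

theorem fracIntegral_congr {f g : ℝ → ℝ} {t : ℝ} (ht : 0 ≤ t) (h : ∀ s ∈ Icc 0 t, f s = g s)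
    (β : ℝ) : fracIntegral β f t = fracIntegral β g t := by
  unfold fracIntegral
  split_ifs
  · exact h t ⟨ht, le_rfl⟩
  · congr 1
    refine intervalIntegral.integral_congr fun s hs => ?_
    rw [uIcc_of_le ht] at hs
    simp only [h s hs]

theorem fracIntegral_mono {f g : ℝ → ℝ} (hf : MeasurableLocallyBounded f)
    (hg : MeasurableLocallyBounded g) {β : ℝ} (hβ : 0 ≤ β) {t : ℝ} (ht : 0 ≤ t)
    (h : ∀ s ∈ Icc 0 t, f s ≤ g s) : fracIntegral β f t ≤ fracIntegral β g t := by
  rcases hβ.eq_or_lt with rfl | hβ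
  · simpa [fracIntegral_zero] using h t ⟨ht, le_rfl⟩
  · rw [fracIntegral_of_pos hβ, fracIntegral_of_pos hβ]
    refine mul_le_mul_of_nonneg_left ?_ (inv_nonneg.2 (Real.Gamma_pos_of_pos hβ).le)
    refine intervalIntegral.integral_mono_on ht (hf.intervalIntegrable_rpow_mul hβ ht)
      (hg.intervalIntegrable_rpow_mul hβ ht) fun s hs => ?_
    exact mul_le_mul_of_nonneg_left (h s hs) (Real.rpow_nonneg (by linarith [hs.2]) _)

theorem fracIntegral_const {β : ℝ} (hβ : 0 ≤ β) (c t : ℝ) :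
    fracIntegral β (fun _ => c) t = c * (t ^ β / Real.Gamma (β + 1)) := by
  rcases hβ.eq_or_lt with rfl | hβ
  · simp [fracIntegral_zero]
  · rw [fracIntegral_of_pos hβ, intervalIntegral.integral_mul_const, integral_sub_rpow hβ,
      Real.Gamma_add_one hβ.ne']
    have := (Real.Gamma_pos_of_pos hβ).ne'
    field_simp

theorem abs_fracIntegral_le {f : ℝ → ℝ} (hf : MeasurableLocallyBounded f) {β : ℝ} (hβ : 0 ≤ β)
    {t C : ℝ} (ht : 0 ≤ t) (h : ∀ s ∈ Icc 0 t, |f s| ≤ C) :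
    |fracIntegral β f t| ≤ C * (t ^ β / Real.Gamma (β + 1)) := by
  have h1 := fracIntegral_mono hf (.const C) hβ ht fun s hs => (abs_le.1 (h s hs)).2
  have h2 := fracIntegral_mono (.const (-C)) hf hβ ht fun s hs => (abs_le.1 (h s hs)).1
  rw [fracIntegral_const hβ] at h1 h2
  exact abs_le.2 ⟨by linarith, h1⟩

/-- The oriented integral is a difference of integrals over `Ioc 0 t` and `Ioc t 0`; each is the
integral over s of a jointly measurable function of (t, s), cut off by an indicator. -/
theorem measurable_fracIntegral {f : ℝ → ℝ} (hf : Measurable f) (β : ℝ) :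
    Measurable (fracIntegral β f) := by
  unfold fracIntegral
  by_cases h : β = 0
  · simpa [h] using hf
  simp only [if_neg h, intervalIntegral]
  have hF : Measurable fun p : ℝ × ℝ => (p.1 - p.2) ^ (β - 1) * f p.2 :=
    ((measurable_fst.sub measurable_snd).pow_const _).mul (hf.comp measurable_snd)
  have h1 : ∀ t : ℝ, ∫ s in Ioc 0 t, (t - s) ^ (β - 1) * f s
      = ∫ s, {p : ℝ × ℝ | 0 < p.2 ∧ p.2 ≤ p.1}.indicator
          (fun p => (p.1 - p.2) ^ (β - 1) * f p.2) (t, s) := fun t => by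
    rw [← integral_indicator measurableSet_Ioc]; rfl
  have h2 : ∀ t : ℝ, ∫ s in Ioc t 0, (t - s) ^ (β - 1) * f s
      = ∫ s, {p : ℝ × ℝ | p.1 < p.2 ∧ p.2 ≤ 0}.indicator
          (fun p => (p.1 - p.2) ^ (β - 1) * f p.2) (t, s) := fun t => by
    rw [← integral_indicator measurableSet_Ioc]; rfl
  simp_rw [h1, h2]
  refine measurable_const.mul (Measurable.sub ?_ ?_)
  · refine (StronglyMeasurable.integral_prod_right' (hF.indicator ?_).stronglyMeasurable).measurable
    exact (measurableSet_lt measurable_const measurable_snd).inter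
      (measurableSet_le measurable_snd measurable_fst)
  · refine (StronglyMeasurable.integral_prod_right' (hF.indicator ?_).stronglyMeasurable).measurable
    exact (measurableSet_lt measurable_fst measurable_snd).inter
      (measurableSet_le measurable_snd measurable_const)

theorem MeasurableLocallyBounded.fracIntegral {f : ℝ → ℝ} (hf : MeasurableLocallyBounded f)
    {β : ℝ} (hβ : 0 ≤ β) : MeasurableLocallyBounded (fracIntegral β f) := by
  refine ⟨measurable_fracIntegral hf.measurable β, fun T => ?_⟩
  obtain ⟨C, hC, hfC⟩ := hf.bounded T
  have hG : 0 < Real.Gamma (β + 1) := Real.Gamma_pos_of_pos (by linarith)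
  refine ⟨C * (|T| ^ β / Real.Gamma (β + 1)), by positivity, fun t ht => ?_⟩
  refine (abs_fracIntegral_le hf hβ ht.1 fun s hs => hfC s ⟨hs.1, hs.2.trans ht.2⟩).trans ?_
  have := Real.rpow_le_rpow ht.1 (ht.2.trans (le_abs_self T)) hβ
  gcongr

/-- Euler's Beta integral, translated and rescaled to [u, t], with the complex powers read back as
real ones. -/
theorem integral_sub_rpow_mul_sub_rpow {a b : ℝ} (ha : 0 < a) (hb : 0 < b) {u t : ℝ}
    (hut : u < t) :
    ∫ s in u..t, (t - s) ^ (a - 1) * (s - u) ^ (b - 1)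
      = Real.Gamma a * Real.Gamma b / Real.Gamma (a + b) * (t - u) ^ (a + b - 1) := by
  have hc := Complex.betaIntegral_scaled (b : ℂ) (a : ℂ) (sub_pos.2 hut)
  rw [Complex.betaIntegral_eq_Gamma_mul_div _ _ (by simpa) (by simpa)] at hc
  have h1 : ∫ s in u..t, (t - s) ^ (a - 1) * (s - u) ^ (b - 1)
      = ∫ x in (0 : ℝ)..(t - u), x ^ (b - 1) * (t - u - x) ^ (a - 1) := by
    have := intervalIntegral.integral_comp_sub_right (a := u) (b := t)
      (fun x : ℝ => x ^ (b - 1) * (t - u - x) ^ (a - 1)) u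
    rw [sub_self] at this
    rw [← this]
    refine intervalIntegral.integral_congr fun s _ => ?_
    simp only [sub_sub_sub_cancel_right, mul_comm]
  have h2 : ((∫ x in (0 : ℝ)..(t - u), x ^ (b - 1) * (t - u - x) ^ (a - 1) : ℝ) : ℂ)
      = ∫ x in (0 : ℝ)..(t - u), (x : ℂ) ^ ((b : ℂ) - 1) * (((t - u : ℝ) : ℂ) - x) ^ ((a : ℂ) - 1) := by
    rw [← intervalIntegral.integral_ofReal]
    refine intervalIntegral.integral_congr fun x hx => ?_
    rw [uIcc_of_le (sub_nonneg.2 hut.le)] at hx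
    simp only [Complex.ofReal_mul]
    rw [Complex.ofReal_cpow hx.1, Complex.ofReal_cpow (sub_nonneg.2 hx.2)]
    push_cast
    rfl
  rw [h1]
  apply Complex.ofReal_injective
  rw [h2, hc]
  push_cast
  rw [Complex.ofReal_cpow (sub_nonneg.2 hut.le), ← Complex.Gamma_ofReal, ← Complex.Gamma_ofReal,
    ← Complex.Gamma_ofReal]
  push_cast
  rw [add_comm (b : ℂ) a]
  ring

/-- Fubini on the triangle u < s: the inner integral over s becomes a Beta integral. Joint
integrability follows from the local bound on f and the integrability of both kernels. -/
theorem integral_rpow_mul_integral_rpow_mul {f : ℝ → ℝ} (hf : MeasurableLocallyBounded f)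
    {a b : ℝ} (ha : 0 < a) (hb : 0 < b) {t : ℝ} (ht : 0 ≤ t) :
    ∫ s in (0 : ℝ)..t, (t - s) ^ (a - 1) * ∫ u in (0 : ℝ)..s, (s - u) ^ (b - 1) * f u
      = Real.Gamma a * Real.Gamma b / Real.Gamma (a + b) *
          ∫ u in (0 : ℝ)..t, (t - u) ^ (a + b - 1) * f u := by
  obtain ⟨C, hC, hfC⟩ := hf.bounded t
  let F : ℝ × ℝ → ℝ := {p : ℝ × ℝ | p.2 < p.1}.indicator
    fun p => (t - p.1) ^ (a - 1) * ((p.1 - p.2) ^ (b - 1) * f p.2)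
  have hF : Measurable F := by
    refine Measurable.indicator ?_ (measurableSet_lt measurable_snd measurable_fst)
    exact ((measurable_const.sub measurable_fst).pow_const _).mul
      (((measurable_fst.sub measurable_snd).pow_const _).mul (hf.measurable.comp measurable_snd))
  have hsec : ∀ s : ℝ, (fun u => F (s, u)) = (Iio s).indicator
      (fun u => (t - s) ^ (a - 1) * ((s - u) ^ (b - 1) * f u)) := fun s => rfl
  have hset : ∀ s ∈ Ioc (0 : ℝ) t, Iio s ∩ Ioc (0 : ℝ) t = Ioo 0 s := fun s hs => by
    ext u
    simp only [mem_inter_iff, mem_Iio, mem_Ioc, mem_Ioo]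
    exact ⟨fun h => ⟨h.2.1, h.1⟩, fun h => ⟨h.2, h.1, h.2.le.trans hs.2⟩⟩
  have hsec_int : ∀ s ∈ Ioc (0 : ℝ) t,
      IntegrableOn (fun u => F (s, u)) (Ioc 0 t) := fun s hs => by
    rw [hsec, integrableOn_indicator_iff measurableSet_Iio, hset s hs]
    exact (((intervalIntegrable_iff_integrableOn_Ioc_of_le hs.1.le).1
      (hf.intervalIntegrable_rpow_mul hb hs.1.le)).mono_set Ioo_subset_Ioc_self).const_mul _
  have hsec_eq : ∀ s ∈ Ioc (0 : ℝ) t, ∫ u in Ioc 0 t, F (s, u)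
      = (t - s) ^ (a - 1) * ∫ u in (0 : ℝ)..s, (s - u) ^ (b - 1) * f u := fun s hs => by
    rw [hsec, integral_indicator measurableSet_Iio, Measure.restrict_restrict measurableSet_Iio,
      hset s hs, intervalIntegral.integral_of_le hs.1.le, integral_Ioc_eq_integral_Ioo,
      integral_const_mul]
  have hnorm : ∀ s ∈ Ioc (0 : ℝ) t, ∫ u in Ioc 0 t, ‖F (s, u)‖
      ≤ (t - s) ^ (a - 1) * (C * (t ^ b / b)) := fun s hs => by
    have hs0 : 0 ≤ t - s := sub_nonneg.2 hs.2
    have h1 : ∫ u in Ioc 0 t, ‖F (s, u)‖ ≤ ∫ u in Ioc 0 t, (Iio s).indicator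
        (fun u => (t - s) ^ (a - 1) * (C * (s - u) ^ (b - 1))) u := by
      refine integral_mono_ae (hsec_int s hs).norm ?_ ?_
      · rw [← IntegrableOn, integrableOn_indicator_iff measurableSet_Iio, hset s hs]
        exact ((((intervalIntegrable_iff_integrableOn_Ioc_of_le hs.1.le).1
          (intervalIntegrable_sub_rpow hb s)).mono_set Ioo_subset_Ioc_self).const_mul _).const_mul _
      · filter_upwards [ae_restrict_mem measurableSet_Ioc] with u hu
        have h2 : F (s, u) = (Iio s).indicator
          (fun u => (t - s) ^ (a - 1) * ((s - u) ^ (b - 1) * f u)) u := rfl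
        rw [h2]
        by_cases hus : u < s
        · rw [indicator_of_mem (show u ∈ Iio s from hus), indicator_of_mem (show u ∈ Iio s from hus),
            Real.norm_eq_abs, abs_mul, abs_mul, abs_of_nonneg (Real.rpow_nonneg hs0 _),
            abs_of_nonneg (Real.rpow_nonneg (sub_nonneg.2 hus.le) _), mul_comm C]
          have := hfC u ⟨hu.1.le, hu.2⟩
          have h3 := Real.rpow_nonneg hs0 (a - 1)
          have h4 := Real.rpow_nonneg (sub_nonneg.2 hus.le) (b - 1)
          gcongr
        · rw [indicator_of_notMem (show u ∉ Iio s from hus),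
            indicator_of_notMem (show u ∉ Iio s from hus), norm_zero]
    refine h1.trans ?_
    rw [integral_indicator measurableSet_Iio, Measure.restrict_restrict measurableSet_Iio,
      hset s hs, ← integral_Ioc_eq_integral_Ioo, integral_const_mul, integral_const_mul,
      ← intervalIntegral.integral_of_le hs.1.le, integral_sub_rpow hb]
    have h3 := Real.rpow_nonneg hs0 (a - 1)
    have h4 := Real.rpow_le_rpow hs.1.le hs.2 hb.le
    gcongr
  have hint : Integrable F ((volume.restrict (Ioc 0 t)).prod (volume.restrict (Ioc 0 t))) := by
    rw [integrable_prod_iff hF.aestronglyMeasurable]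
    constructor
    · filter_upwards [ae_restrict_mem measurableSet_Ioc] with s hs using hsec_int s hs
    · refine Integrable.mono' (g := fun s => (t - s) ^ (a - 1) * (C * (t ^ b / b))) ?_ ?_ ?_
      · exact ((intervalIntegrable_iff_integrableOn_Ioc_of_le ht).1
          (intervalIntegrable_sub_rpow ha t)).mul_const _
      · exact (StronglyMeasurable.integral_prod_right'
          hF.norm.stronglyMeasurable).aestronglyMeasurable
      · filter_upwards [ae_restrict_mem measurableSet_Ioc] with s hs
        rw [Real.norm_of_nonneg (integral_nonneg fun u => norm_nonneg _)]
        exact hnorm s hs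
  have hswap := integral_integral_swap (f := fun s u => F (s, u)) hint
  rw [setIntegral_congr_fun measurableSet_Ioc hsec_eq] at hswap
  rw [intervalIntegral.integral_of_le ht, hswap, intervalIntegral.integral_of_le ht,
    -- The endpoint u = t is dropped because the Beta formula needs u < t.
    ← integral_const_mul, integral_Ioc_eq_integral_Ioo, integral_Ioc_eq_integral_Ioo]
  refine setIntegral_congr_fun measurableSet_Ioo fun u hu => ?_
  have hsec' : (fun s => F (s, u)) = (Ioi u).indicator
      (fun s => (t - s) ^ (a - 1) * ((s - u) ^ (b - 1) * f u)) := rfl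
  have hset' : Ioi u ∩ Ioc (0 : ℝ) t = Ioc u t := by
    ext s
    simp only [mem_inter_iff, mem_Ioi, mem_Ioc]
    exact ⟨fun h => ⟨h.1, h.2.2⟩, fun h => ⟨h.1, hu.1.trans h.1, h.2⟩⟩
  simp only [hsec']
  rw [integral_indicator measurableSet_Ioi, Measure.restrict_restrict measurableSet_Ioi, hset',
    ← intervalIntegral.integral_of_le hu.2.le]
  simp_rw [← mul_assoc]
  rw [intervalIntegral.integral_mul_const, integral_sub_rpow_mul_sub_rpow ha hb hu.2]

theorem fracIntegral_fracIntegral {f : ℝ → ℝ} (hf : MeasurableLocallyBounded f)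
    {a b : ℝ} (ha : 0 ≤ a) (hb : 0 ≤ b) {t : ℝ} (ht : 0 ≤ t) :
    fracIntegral a (fracIntegral b f) t = fracIntegral (a + b) f t := by
  rcases ha.eq_or_lt with rfl | ha
  · simp [fracIntegral_zero]
  rcases hb.eq_or_lt with rfl | hb
  · simp [fracIntegral_zero]
  rw [fracIntegral_of_pos ha, fracIntegral_of_pos (add_pos ha hb)]
  have h : ∀ s : ℝ, (t - s) ^ (a - 1) * fracIntegral b f s = (Real.Gamma b)⁻¹ *
      ((t - s) ^ (a - 1) * ∫ u in (0 : ℝ)..s, (s - u) ^ (b - 1) * f u) := fun s => by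
    rw [fracIntegral_of_pos hb]; ring
  simp_rw [h]
  rw [intervalIntegral.integral_const_mul, integral_rpow_mul_integral_rpow_mul hf ha hb ht]
  have h1 := (Real.Gamma_pos_of_pos ha).ne'
  have h2 := (Real.Gamma_pos_of_pos hb).ne'
  field_simp

/-- The substitution s = t v fixes both the domain and the singular kernel, so that continuity in t
can be read off by dominated convergence. -/
theorem fracIntegral_eq_rpow_mul_integral {β : ℝ} (hβ : 0 < β) (f : ℝ → ℝ) {t : ℝ} (ht : 0 ≤ t) :
    fracIntegral β f t
      = (Real.Gamma β)⁻¹ * (t ^ β * ∫ v in (0 : ℝ)..1, (1 - v) ^ (β - 1) * f (t * v)) := by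
  rw [fracIntegral_of_pos hβ]
  rcases ht.eq_or_lt with rfl | ht
  · simp [Real.zero_rpow hβ.ne']
  have h := intervalIntegral.integral_comp_mul_left (a := 0) (b := 1)
    (fun s : ℝ => (t - s) ^ (β - 1) * f s) ht.ne'
  simp only [mul_zero, mul_one, smul_eq_mul] at h
  rw [eq_inv_mul_iff_mul_eq₀ ht.ne'] at h
  rw [← h]
  refine congrArg ((Real.Gamma β)⁻¹ * ·) ?_
  rw [← intervalIntegral.integral_const_mul, ← intervalIntegral.integral_const_mul]
  refine intervalIntegral.integral_congr fun v hv => ?_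
  rw [uIcc_of_le zero_le_one] at hv
  have h1 : t - t * v = t * (1 - v) := by ring
  have h2 : t ^ β = t * t ^ (β - 1) := by
    rw [Real.rpow_sub_one ht.ne']; field_simp
  simp only [h1, Real.mul_rpow ht.le (sub_nonneg.2 hv.2), h2]
  ring

theorem continuousOn_fracIntegral {f : ℝ → ℝ} (hf : Continuous f) {β : ℝ} (hβ : 0 ≤ β) :
    ContinuousOn (fracIntegral β f) (Ici 0) := by
  rcases hβ.eq_or_lt with rfl | hβ
  · simpa [fracIntegral_zero] using hf.continuousOn
  refine ContinuousOn.congr ?_ fun t ht => fracIntegral_eq_rpow_mul_integral hβ f ht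
  refine continuousOn_const.mul ((Real.continuous_rpow_const hβ.le).continuousOn.mul ?_)
  refine fun t₀ ht₀ => ContinuousAt.continuousWithinAt ?_
  obtain ⟨C, hC⟩ := (isCompact_Icc (a := -(|t₀| + 1)) (b := |t₀| + 1)).exists_bound_of_continuousOn
    hf.continuousOn
  have hm : Measurable fun v : ℝ => (1 - v) ^ (β - 1) :=
    (measurable_const.sub measurable_id).pow_const _
  refine intervalIntegral.continuousAt_of_dominated_interval
    (bound := fun v => (1 - v) ^ (β - 1) * C) ?_ ?_ ?_ ?_
  · refine Filter.Eventually.of_forall fun t => ?_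
    exact (hm.mul (hf.measurable.comp (measurable_const.mul measurable_id))).aestronglyMeasurable
  · filter_upwards [Metric.ball_mem_nhds t₀ one_pos] with t ht
    refine Filter.Eventually.of_forall fun v hv => ?_
    rw [uIoc_of_le zero_le_one] at hv
    rw [Real.norm_eq_abs, abs_mul, abs_of_nonneg (Real.rpow_nonneg (sub_nonneg.2 hv.2) _)]
    refine mul_le_mul_of_nonneg_left (hC _ ?_) (Real.rpow_nonneg (sub_nonneg.2 hv.2) _)
    rw [mem_Icc, ← abs_le, abs_mul, abs_of_pos hv.1]
    rw [Metric.mem_ball, Real.dist_eq] at ht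
    have h1 : |t| ≤ |t₀| + 1 := by
      have := abs_sub_abs_le_abs_sub t t₀
      linarith
    exact (mul_le_of_le_one_right (abs_nonneg t) hv.2).trans h1
  · exact (intervalIntegrable_sub_rpow hβ 1).mul_const C
  · refine Filter.Eventually.of_forall fun v _ => ?_
    exact (continuous_const.mul (hf.comp (continuous_id.mul continuous_const))).continuousAt

/-! ### Growth of Γ and convergence of Mittag-Leffler type series. -/

/-- Only the part of Euler's integral over (κ, κ + 1] is kept. As κ is free, Γ outgrows every
exponential. -/
theorem rpow_mul_exp_le_Gamma {κ s : ℝ} (hκ : 0 < κ) (hs : 1 ≤ s) :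
    κ ^ (s - 1) * Real.exp (-(κ + 1)) ≤ Real.Gamma s := by
  rw [Real.Gamma_eq_integral (by linarith)]
  have hint := Real.GammaIntegral_convergent (s := s) (by linarith)
  have hsub : Ioc κ (κ + 1) ⊆ Ioi (0 : ℝ) := fun x hx => hκ.trans hx.1
  calc κ ^ (s - 1) * Real.exp (-(κ + 1))
      = ∫ _ in Ioc κ (κ + 1), κ ^ (s - 1) * Real.exp (-(κ + 1)) := by simp
    _ ≤ ∫ x in Ioc κ (κ + 1), Real.exp (-x) * x ^ (s - 1) := by
        refine setIntegral_mono_on (integrableOn_const (by simp)) (hint.mono_set hsub) measurableSet_Ioc fun x hx => ?_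
        rw [mul_comm]
        have h1 : κ ^ (s - 1) ≤ x ^ (s - 1) :=
          Real.rpow_le_rpow hκ.le hx.1.le (by linarith)
        have h2 : Real.exp (-(κ + 1)) ≤ Real.exp (-x) := Real.exp_le_exp.2 (by linarith [hx.2])
        gcongr
    _ ≤ ∫ x in Ioi 0, Real.exp (-x) * x ^ (s - 1) := by
        refine setIntegral_mono_set hint ?_ hsub.eventuallyLE
        filter_upwards [ae_restrict_mem measurableSet_Ioi] with x hx
        exact mul_nonneg (Real.exp_pos _).le (Real.rpow_nonneg (le_of_lt hx) _)

/-- Choosing κ with κ^α ≥ 2|x| in the lower bound for Γ dominates the terms by a multiple of (k + 1)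
2^{-k}, once αk ≥ 1. The weight k + 1 is that of the functions E^2. -/
theorem summable_succ_mul_pow_div_Gamma {α : ℝ} (hα : 0 < α) {γ : ℝ} (hγ : 0 ≤ γ) (x : ℝ) :
    Summable fun k : ℕ => ((k : ℝ) + 1) * x ^ k / Real.Gamma (α * k + γ) := by
  obtain ⟨κ, hκ, hκx⟩ : ∃ κ : ℝ, 1 ≤ κ ∧ 2 * |x| ≤ κ ^ α := by
    refine ⟨max 1 ((2 * |x|) ^ α⁻¹), le_max_left _ _, ?_⟩
    calc 2 * |x| = ((2 * |x|) ^ α⁻¹) ^ α := (Real.rpow_inv_rpow (by positivity) hα.ne').symm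
      _ ≤ _ := Real.rpow_le_rpow (by positivity) (le_max_right _ _) hα.le
  have hκ0 : 0 < κ := by linarith
  have hgeo : Summable fun k : ℕ =>
      (((k : ℝ) + 1) * (1 / 2) ^ k) * (κ * Real.exp (κ + 1)) := by
    refine Summable.mul_right _ ?_
    have h1 := summable_pow_mul_geometric_of_norm_lt_one 1 (r := (1 / 2 : ℝ)) (by norm_num)
    have h2 := summable_geometric_of_lt_one (r := (1 / 2 : ℝ)) (by norm_num) (by norm_num)
    refine (h1.add h2).congr fun k => ?_
    ring
  refine Summable.of_norm_bounded_eventually_nat hgeo ?_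
  obtain ⟨N, hN⟩ := exists_nat_ge (1 / α)
  filter_upwards [Filter.eventually_ge_atTop N] with k hk
  have hk1 : 1 ≤ α * k := by
    have : 1 / α ≤ k := hN.trans (by exact_mod_cast hk)
    rwa [div_le_iff₀ hα, mul_comm] at this
  have hG := rpow_mul_exp_le_Gamma hκ0 (s := α * k + γ) (by linarith)
  have h1 : κ ^ (α * k - 1) ≤ κ ^ (α * k + γ - 1) :=
    Real.rpow_le_rpow_of_exponent_le hκ (by linarith)
  have h2 : κ ^ (α * k - 1) = (κ ^ α) ^ k / κ := by
    rw [Real.rpow_sub_one hκ0.ne', Real.rpow_mul hκ0.le, Real.rpow_natCast]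
  have h3 : (2 * |x|) ^ k ≤ (κ ^ α) ^ k := pow_le_pow_left₀ (by positivity) hκx k
  have h4 : (2 * |x|) ^ k / κ * Real.exp (-(κ + 1)) ≤ Real.Gamma (α * k + γ) := by
    refine le_trans ?_ hG
    rw [h2] at h1
    have : (2 * |x|) ^ k / κ ≤ κ ^ (α * k + γ - 1) := le_trans (by gcongr) h1
    gcongr
  have hGpos : 0 < Real.Gamma (α * k + γ) := Real.Gamma_pos_of_pos (by linarith)
  rw [norm_div, norm_mul, norm_pow, Real.norm_of_nonneg (by positivity : (0 : ℝ) ≤ k + 1),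
    Real.norm_of_nonneg hGpos.le, div_le_iff₀ hGpos, Real.norm_eq_abs]
  calc ((k : ℝ) + 1) * |x| ^ k
      = ((k : ℝ) + 1) * (1 / 2) ^ k * (κ * Real.exp (κ + 1)) *
          ((2 * |x|) ^ k / κ * Real.exp (-(κ + 1))) := by
        rw [Real.exp_neg, mul_pow, one_div, inv_pow]
        field_simp
    _ ≤ _ := by gcongr

theorem summable_pow_div_Gamma {α : ℝ} (hα : 0 < α) {γ : ℝ} (hγ : 0 ≤ γ) (x : ℝ) :
    Summable fun k : ℕ => x ^ k / Real.Gamma (α * k + γ) := by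
  refine Summable.of_norm_bounded (summable_succ_mul_pow_div_Gamma hα hγ |x|) fun k => ?_
  rcases (show 0 ≤ α * k + γ by positivity).eq_or_lt with h | h
  · simp [← h]
  have hG := Real.Gamma_pos_of_pos h
  rw [norm_div, norm_pow, Real.norm_of_nonneg hG.le, Real.norm_eq_abs]
  have : |x| ^ k ≤ (k + 1) * |x| ^ k :=
    le_mul_of_one_le_left (by positivity) (by linarith [(Nat.cast_nonneg k : (0 : ℝ) ≤ k)])
  gcongr

/-! ### Fractional Volterra inequalities and equations. -/

/-- Insert the inequality into its own remainder K times: J is positive, has the semigroup property,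
and maps constants to explicit powers. -/
theorem le_sum_add_fracIntegral {u : ℝ → ℝ} (hu : MeasurableLocallyBounded u) {α a c T : ℝ}
    (hα : 0 < α) (hc : 0 ≤ c) (h : ∀ s ∈ Icc 0 T, u s ≤ a + c * fracIntegral α u s) (K : ℕ)
    {t : ℝ} (ht : t ∈ Icc 0 T) :
    u t ≤ a * ∑ k ∈ Finset.range K, (c * t ^ α) ^ k / Real.Gamma (α * k + 1)
      + c ^ K * fracIntegral (α * K) u t := by
  induction K with
  | zero => simp [fracIntegral_zero]
  | succ K ih =>
    have hK : 0 ≤ α * K := by positivity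
    have hJ := hu.fracIntegral hα.le
    have h1 : fracIntegral (α * K) u t
        ≤ a * (t ^ (α * K) / Real.Gamma (α * K + 1)) + c * fracIntegral (α * K + α) u t := by
      refine (fracIntegral_mono hu ((MeasurableLocallyBounded.const a).add (hJ.const_mul c)) hK ht.1
        fun s hs => h s ⟨hs.1, hs.2.trans ht.2⟩).trans_eq ?_
      rw [fracIntegral_add (.const a) (hJ.const_mul c) hK ht.1, fracIntegral_const hK,
        fracIntegral_const_mul, fracIntegral_fracIntegral hu hK hα.le ht.1]
    have h2 := mul_le_mul_of_nonneg_left h1 (pow_nonneg hc K)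
    have h3 : α * ((K + 1 : ℕ) : ℝ) = α * K + α := by push_cast; ring
    rw [Finset.sum_range_succ, h3]
    refine ih.trans ?_
    rw [Real.rpow_mul ht.1, Real.rpow_natCast] at h2
    rw [mul_pow c]
    refine (add_le_add_right h2 _).trans_eq ?_
    ring

/-- A Grönwall inequality for the fractional integral. -/
theorem le_mul_tsum_of_le_add_fracIntegral {u : ℝ → ℝ} (hu : MeasurableLocallyBounded u)
    {α a c T : ℝ} (hα : 0 < α) (ha : 0 ≤ a) (hc : 0 ≤ c)
    (h : ∀ s ∈ Icc 0 T, u s ≤ a + c * fracIntegral α u s) {t : ℝ} (ht : t ∈ Icc 0 T) :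
    u t ≤ a * ∑' k : ℕ, (c * T ^ α) ^ k / Real.Gamma (α * k + 1) := by
  obtain ⟨B, hB, huB⟩ := hu.bounded T
  have hs := summable_pow_div_Gamma hα zero_le_one (c * T ^ α)
  -- The remainder c^K J^{αK} u is at most B times the K-th term of the convergent series, so it
  -- vanishes in the limit.
  have hlim : Filter.Tendsto (fun K : ℕ =>
      a * ∑ k ∈ Finset.range K, (c * T ^ α) ^ k / Real.Gamma (α * k + 1)
        + B * ((c * T ^ α) ^ K / Real.Gamma (α * K + 1))) Filter.atTop
      (nhds (a * ∑' k : ℕ, (c * T ^ α) ^ k / Real.Gamma (α * k + 1))) := by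
    simpa using (hs.hasSum.tendsto_sum_nat.const_mul a).add
      (hs.tendsto_atTop_zero.const_mul B)
  refine ge_of_tendsto' hlim fun K => (le_sum_add_fracIntegral hu hα hc h K ht).trans ?_
  have hG : ∀ k : ℕ, 0 < Real.Gamma (α * k + 1) := fun k => Real.Gamma_pos_of_pos (by positivity)
  have htT : t ^ α ≤ T ^ α := Real.rpow_le_rpow ht.1 ht.2 hα.le
  have ht0 : 0 ≤ t ^ α := Real.rpow_nonneg ht.1 _
  have hpow : ∀ k : ℕ, (c * t ^ α) ^ k / Real.Gamma (α * k + 1)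
      ≤ (c * T ^ α) ^ k / Real.Gamma (α * k + 1) := fun k => by
    have := hG k
    gcongr
  refine add_le_add (mul_le_mul_of_nonneg_left (Finset.sum_le_sum fun k _ => hpow k) ha) ?_
  have h1 := (le_abs_self _).trans (abs_fracIntegral_le hu (by positivity : 0 ≤ α * K) ht.1
    fun s hs => huB s ⟨hs.1, hs.2.trans ht.2⟩)
  refine (mul_le_mul_of_nonneg_left h1 (pow_nonneg hc K)).trans ?_
  refine le_trans (le_of_eq ?_) (mul_le_mul_of_nonneg_left (hpow K) hB)
  rw [Real.rpow_mul ht.1, Real.rpow_natCast, mul_pow]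
  ring

theorem summable_succ_mul_pow_mul_fracIntegral {f : ℝ → ℝ} (hf : MeasurableLocallyBounded f)
    {α γ : ℝ} (hα : 0 < α) (hγ : 0 ≤ γ) (c : ℝ) {t : ℝ} (ht : 0 ≤ t) :
    Summable fun k : ℕ => ((k : ℝ) + 1) * c ^ k * fracIntegral (α * k + γ) f t := by
  obtain ⟨C, hC, hfC⟩ := hf.bounded t
  have hs := (summable_succ_mul_pow_div_Gamma hα (add_nonneg hγ zero_le_one)
    (|c| * t ^ α)).mul_left (C * t ^ γ)
  refine Summable.of_norm_bounded hs fun k => ?_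
  have hk : 0 ≤ α * k + γ := by positivity
  rw [norm_mul, norm_mul, norm_pow, Real.norm_of_nonneg (by positivity : (0 : ℝ) ≤ k + 1),
    Real.norm_eq_abs, Real.norm_eq_abs]
  refine (mul_le_mul_of_nonneg_left (abs_fracIntegral_le hf hk ht hfC)
    (by positivity)).trans_eq ?_
  have h1 : t ^ (α * k + γ) = (t ^ α) ^ k * t ^ γ := by
    rw [Real.rpow_add_of_nonneg ht (by positivity) hγ, Real.rpow_mul ht, Real.rpow_natCast]
  rw [h1, mul_pow, add_assoc]
  ring

theorem summable_pow_mul_fracIntegral {f : ℝ → ℝ} (hf : MeasurableLocallyBounded f)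
    {α γ : ℝ} (hα : 0 < α) (hγ : 0 ≤ γ) (c : ℝ) {t : ℝ} (ht : 0 ≤ t) :
    Summable fun k : ℕ => c ^ k * fracIntegral (α * k + γ) f t := by
  refine Summable.of_norm_bounded
    (summable_succ_mul_pow_mul_fracIntegral hf hα hγ c ht).norm fun k => ?_
  rw [mul_assoc, norm_mul ((k : ℝ) + 1), Real.norm_of_nonneg (by positivity : (0 : ℝ) ≤ k + 1)]
  exact le_mul_of_one_le_left (norm_nonneg _) (by linarith [(Nat.cast_nonneg k : (0 : ℝ) ≤ k)])

/-- Formally u = (1 - cJ)^{-1} f + d J (1 - cJ)^{-2} g with J = J^α, and (1 - x)^{-2} = ∑ (k + 1)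
x^k. This is the K-step expansion with both remainders kept. -/
theorem eq_sum_add_of_eq_add_fracIntegral {u v f g : ℝ → ℝ} (hu : MeasurableLocallyBounded u)
    (hv : MeasurableLocallyBounded v) (hf : MeasurableLocallyBounded f)
    (hg : MeasurableLocallyBounded g) {α c d : ℝ} (hα : 0 < α)
    (hv_eq : ∀ t, 0 ≤ t → v t = g t + c * fracIntegral α v t)
    (hu_eq : ∀ t, 0 ≤ t → u t = f t + d * fracIntegral α v t + c * fracIntegral α u t)
    {t : ℝ} (ht : 0 ≤ t) (K : ℕ) :
    u t = ∑ k ∈ Finset.range K, c ^ k * fracIntegral (α * k + 0) f t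
      + d * ∑ k ∈ Finset.range K, ((k : ℝ) + 1) * c ^ k * fracIntegral (α * k + α) g t
      + d * (K * c ^ K * fracIntegral (α * K + α) v t)
      + c ^ K * fracIntegral (α * K + 0) u t := by
  induction K with
  | zero => simp [fracIntegral_zero]
  | succ K ih =>
    have hK : 0 ≤ α * K := by positivity
    have hJu := hu.fracIntegral hα.le
    have hJv := hv.fracIntegral hα.le
    have h1 : fracIntegral (α * K) u t = fracIntegral (α * K) f t
        + d * fracIntegral (α * K + α) v t + c * fracIntegral (α * K + α) u t := by
      rw [fracIntegral_congr ht (fun s hs => hu_eq s hs.1),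
        fracIntegral_add (hf.add (hJv.const_mul d)) (hJu.const_mul c) hK ht,
        fracIntegral_add hf (hJv.const_mul d) hK ht, fracIntegral_const_mul,
        fracIntegral_const_mul, fracIntegral_fracIntegral hv hK hα.le ht,
        fracIntegral_fracIntegral hu hK hα.le ht]
    have hKα : 0 ≤ α * K + α := by positivity
    have h2 : fracIntegral (α * K + α) v t = fracIntegral (α * K + α) g t
        + c * fracIntegral (α * K + α + α) v t := by
      rw [fracIntegral_congr ht (fun s hs => hv_eq s hs.1),
        fracIntegral_add hg (hJv.const_mul c) hKα ht, fracIntegral_const_mul,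
        fracIntegral_fracIntegral hv hKα hα.le ht]
    have h3 : α * ((K + 1 : ℕ) : ℝ) = α * K + α := by push_cast; ring
    rw [Finset.sum_range_succ, Finset.sum_range_succ, h3]
    simp only [add_zero] at ih ⊢
    rw [ih, h1, h2]
    push_cast
    ring

/-- Solution of a triangular system of two linear fractional integral equations. -/
theorem eq_tsum_of_eq_add_fracIntegral {u v f g : ℝ → ℝ} (hu : MeasurableLocallyBounded u)
    (hv : MeasurableLocallyBounded v) (hf : MeasurableLocallyBounded f)
    (hg : MeasurableLocallyBounded g) {α c d : ℝ} (hα : 0 < α)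
    (hv_eq : ∀ t, 0 ≤ t → v t = g t + c * fracIntegral α v t)
    (hu_eq : ∀ t, 0 ≤ t → u t = f t + d * fracIntegral α v t + c * fracIntegral α u t)
    {t : ℝ} (ht : 0 ≤ t) :
    u t = ∑' k : ℕ, c ^ k * fracIntegral (α * k) f t
      + d * ∑' k : ℕ, ((k : ℝ) + 1) * c ^ k * fracIntegral (α * k + α) g t := by
  have hsf := (summable_pow_mul_fracIntegral hf hα le_rfl c ht)
  have hsg := (summable_succ_mul_pow_mul_fracIntegral hg hα hα.le c ht)
  have hsu := (summable_pow_mul_fracIntegral hu hα le_rfl c ht)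
  have hsv := (summable_succ_mul_pow_mul_fracIntegral hv hα hα.le c ht)
  -- The remainders are themselves terms of convergent series, hence tend to 0; weight k is obtained
  -- as (k + 1) - 1.
  have hsv' : Summable fun k : ℕ => (k : ℝ) * c ^ k * fracIntegral (α * k + α) v t := by
    refine (hsv.sub (summable_pow_mul_fracIntegral hv hα hα.le c ht)).congr fun k => ?_
    ring
  have hlim := (((hsf.hasSum.tendsto_sum_nat.add (hsg.hasSum.tendsto_sum_nat.const_mul d)).add
    (hsv'.tendsto_atTop_zero.const_mul d)).add hsu.tendsto_atTop_zero)
  have hconst := hlim.congr fun K =>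
    (eq_sum_add_of_eq_add_fracIntegral hu hv hf hg hα hv_eq hu_eq ht K).symm
  simpa using tendsto_nhds_unique tendsto_const_nhds hconst

/-! ### From Caputo derivatives to integral equations. -/

/-- Inversion of the Caputo derivative. -/
theorem eq_add_fracIntegral_of_hasCaputoDerivAt {α : ℝ} (hα0 : 0 < α) (hα1 : α ≤ 1)
    {f F : ℝ → ℝ} (hf : Continuous f) (hF : Continuous F)
    (h : ∀ t, 0 < t → HasCaputoDerivAt α f (F t) t) {t : ℝ} (ht : 0 ≤ t) :
    f t = f 0 + fracIntegral α F t := by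
  have hα1' : 0 ≤ 1 - α := sub_nonneg.2 hα1
  set g : ℝ → ℝ := fun s => f s - f 0 with hg_def
  have hg : Continuous g := hf.sub continuous_const
  have hg' := MeasurableLocallyBounded.of_continuous hg
  have hF' := MeasurableLocallyBounded.of_continuous hF
  -- For α < 1 the integral is over a degenerate interval; for α = 1 the value is g 0 = 0.
  have h0 : fracIntegral (1 - α) g 0 = 0 := by
    unfold fracIntegral
    split_ifs <;> simp [hg_def]
  have hint : ∀ s, 0 ≤ s → fracIntegral (1 - α) g s = fracIntegral 1 F s := fun s hs => by
    have := intervalIntegral.integral_eq_sub_of_hasDerivAt_of_le hs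
      ((continuousOn_fracIntegral hg hα1').mono Icc_subset_Ici_self)
      (fun x hx => h x hx.1) (hF.intervalIntegrable _ _)
    rw [fracIntegral_one, this, h0, sub_zero]
  -- Freezing J^α F at its value at 0 for negative times makes it continuous on the whole line, as
  -- the fundamental theorem of calculus requires below.
  let G : ℝ → ℝ := fun s => fracIntegral α F (max s 0)
  have hG : Continuous G :=
    (continuousOn_fracIntegral hF hα0.le).comp_continuous (by fun_prop) fun s =>
      mem_Ici.2 (le_max_right _ _)
  have hint2 : ∀ s, 0 ≤ s → ∫ x in (0 : ℝ)..s, g x = ∫ x in (0 : ℝ)..s, G x := fun s hs => by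
    -- Applying J^α to J^{1-α} g = J^1 F gives J^1 g = J^1 (J^α F); differentiating at t > 0 then
    -- gives g = J^α F.
    have e1 := fracIntegral_congr hs (fun x hx => hint x hx.1) α
    rw [fracIntegral_fracIntegral hg' hα0.le hα1' hs,
      fracIntegral_fracIntegral hF' hα0.le zero_le_one hs, add_sub_cancel, add_comm α 1,
      ← fracIntegral_fracIntegral hF' zero_le_one hα0.le hs, fracIntegral_one,
      fracIntegral_one] at e1
    rw [e1]
    refine intervalIntegral.integral_congr fun x hx => ?_
    rw [uIcc_of_le hs] at hx
    simp only [G, max_eq_left hx.1]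
  rcases ht.eq_or_lt with rfl | ht
  · simp [fracIntegral_of_pos hα0]
  · have e2 : deriv (fun s => ∫ x in (0 : ℝ)..s, g x) t = deriv (fun s => ∫ x in (0 : ℝ)..s, G x) t :=
      Filter.EventuallyEq.deriv_eq (by
        filter_upwards [lt_mem_nhds ht] with s hs using hint2 s (le_of_lt hs))
    rw [hg.deriv_integral, hG.deriv_integral] at e2
    have e3 : f t - f 0 = fracIntegral α F t := by
      simpa only [hg_def, G, max_eq_left ht.le] using e2
    linarith

/-! ### Forward equations, generator and truncated test functions. -/

/-- The right-hand sides of the Kolmogorov forward equations of the queue with catastrophes, for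
state probabilities `p`. -/
def forwardRate (lam μ ξ : ℝ) (p : ℕ → ℝ → ℝ) : ℕ → ℝ → ℝ
  | 0, s => -(lam + ξ) * p 0 s + μ * p 1 s + ξ
  | n + 1, s => -(lam + μ + ξ) * p (n + 1) s + lam * p n s + μ * p (n + 2) s

/-- The generator of the queue with catastrophes; the truncated `0 - 1 = 0` switches the service
term off in the empty state. -/
def queueGenerator (lam μ ξ : ℝ) (φ : ℕ → ℝ) (n : ℕ) : ℝ :=
  lam * (φ (n + 1) - φ n) + μ * (φ (n - 1) - φ n) + ξ * (φ 0 - φ n)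

/-- Summation by parts moves the forward operator onto ψ, leaving boundary terms at N. The source ξ
in state 0 already encodes total mass one, so ξ ψ 0 appears as a constant and is removed from the
generator. -/
theorem sum_mul_forwardRate (lam μ ξ : ℝ) (p : ℕ → ℝ → ℝ) (ψ : ℕ → ℝ) (s : ℝ) (N : ℕ) :
    ∑ n ∈ Finset.range (N + 1), ψ n * forwardRate lam μ ξ p n s
      = ∑ n ∈ Finset.range (N + 1), (queueGenerator lam μ ξ ψ n - ξ * ψ 0) * p n s
        + ξ * ψ 0 + μ * ψ N * p (N + 1) s - lam * ψ (N + 1) * p N s := by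
  induction N with
  | zero => simp [forwardRate, queueGenerator]; ring
  | succ N ih =>
    rw [Finset.sum_range_succ, ih, Finset.sum_range_succ _ (N + 1)]
    simp only [forwardRate, queueGenerator, Nat.add_sub_cancel]
    ring

theorem sum_mul_fracIntegral {ι : Type*} (S : Finset ι) (a : ι → ℝ) {F : ι → ℝ → ℝ}
    (hF : ∀ n, Continuous (F n)) {β : ℝ} (hβ : 0 ≤ β) {t : ℝ} (ht : 0 ≤ t) :
    ∑ n ∈ S, a n * fracIntegral β (F n) t = fracIntegral β (fun s => ∑ n ∈ S, a n * F n s) t := by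
  classical
  induction S using Finset.induction_on with
  | empty =>
    simp only [Finset.sum_empty]
    rw [fracIntegral_const hβ, zero_mul]
  | insert n S hn ih =>
    simp only [Finset.sum_insert hn]
    rw [fracIntegral_add (.const_mul _ (.of_continuous (hF n)))
      (.of_continuous (by fun_prop)) hβ ht, fracIntegral_const_mul, ih]

section StateMean

variable {Ω : Type*} [MeasurableSpace Ω]

/-- The expectation of `φ (X t)` under `Q`, for real times. -/
noncomputable def stateMean (Q : Measure Ω) (X : ℝ≥0 → Ω → ℕ) (φ : ℕ → ℝ) (t : ℝ) : ℝ :=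
  ∫ ω, φ (X t.toNNReal ω) ∂Q

/-- The probability under `Q` of state `n`, for real times. -/
noncomputable def stateProb (Q : Measure Ω) (X : ℝ≥0 → Ω → ℕ) (n : ℕ) (t : ℝ) : ℝ :=
  Q.real (X t.toNNReal ⁻¹' {n})

/-- The state probabilities of `X` under `Q` are continuous solutions of the fractional forward
equations with initial state `i`, in integrated form. -/
structure SolvesForward (Q : Measure Ω) (X : ℝ≥0 → Ω → ℕ) (α lam μ ξ : ℝ) (i : ℕ) : Prop where
  measurable : ∀ t, Measurable (X t)
  continuous : ∀ n, Continuous (stateProb Q X n)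
  eq_add : ∀ n t, 0 ≤ t → stateProb Q X n t = (if i = n then 1 else 0)
    + fracIntegral α (forwardRate lam μ ξ (stateProb Q X) n) t

theorem sum_range_ite_of_eq_zero {ψ : ℕ → ℝ} {N : ℕ} (hψ : ∀ n, N ≤ n → ψ n = 0) (m : ℕ) :
    ∑ n ∈ Finset.range N, ψ n * (if m = n then 1 else 0) = ψ m := by
  simp only [mul_ite, mul_one, mul_zero, Finset.sum_ite_eq, Finset.mem_range]
  split_ifs with h
  · rfl
  · exact (hψ m (not_lt.1 h)).symm

namespace SolvesForward

variable {Q : Measure Ω} {X : ℝ≥0 → Ω → ℕ} {α lam μ ξ : ℝ} {i : ℕ}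

theorem measurable_comp (h : SolvesForward Q X α lam μ ξ i) (φ : ℕ → ℝ) (t : ℝ≥0) :
    Measurable fun ω => φ (X t ω) :=
  (measurable_of_countable φ).comp (h.measurable t)

theorem continuous_forwardRate (h : SolvesForward Q X α lam μ ξ i) (n : ℕ) :
    Continuous (forwardRate lam μ ξ (stateProb Q X) n) := by
  have := h.continuous
  cases n with
  | zero => unfold forwardRate; fun_prop
  | succ n => unfold forwardRate; fun_prop

variable [IsProbabilityMeasure Q]

theorem integrable_of_eventually_const (h : SolvesForward Q X α lam μ ξ i) {φ : ℕ → ℝ} {N : ℕ}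
    {c : ℝ} (hφ : ∀ n, N ≤ n → φ n = c) (t : ℝ≥0) : Integrable (fun ω => φ (X t ω)) Q := by
  refine Integrable.of_bound (h.measurable_comp φ t).aestronglyMeasurable
    (|c| + ∑ n ∈ Finset.range N, |φ n|) (Filter.Eventually.of_forall fun ω => ?_)
  rcases lt_or_ge (X t ω) N with hn | hn
  · have := Finset.single_le_sum (f := fun n => |φ n|) (fun n _ => abs_nonneg (φ n))
      (Finset.mem_range.2 hn)
    exact this.trans (le_add_of_nonneg_left (abs_nonneg c))
  · rw [hφ _ hn]
    exact le_add_of_nonneg_right (Finset.sum_nonneg fun n _ => abs_nonneg (φ n))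

theorem stateMean_eq_sum (h : SolvesForward Q X α lam μ ξ i) {ψ : ℕ → ℝ} {N : ℕ}
    (hψ : ∀ n, N ≤ n → ψ n = 0) (t : ℝ) :
    stateMean Q X ψ t = ∑ n ∈ Finset.range N, ψ n * stateProb Q X n t := by
  have h1 : ∀ ω, ψ (X t.toNNReal ω) = ∑ n ∈ Finset.range N,
      ψ n * (X t.toNNReal ⁻¹' {n}).indicator (fun _ => (1 : ℝ)) ω := fun ω => by
    rw [← sum_range_ite_of_eq_zero hψ]
    refine Finset.sum_congr rfl fun n _ => ?_
    by_cases hn : X t.toNNReal ω = n <;> simp [hn]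
  have hmeas : ∀ n, MeasurableSet (X t.toNNReal ⁻¹' {n}) := fun n =>
    h.measurable _ (measurableSet_singleton n)
  simp_rw [stateMean, h1]
  rw [integral_finsetSum _ fun n _ =>
    (((integrable_const (1 : ℝ)).indicator (hmeas n)).const_mul _)]
  refine Finset.sum_congr rfl fun n _ => ?_
  rw [integral_const_mul, integral_indicator_const _ (hmeas n), smul_eq_mul, mul_one]
  rfl

/-- Since Q has mass one, subtracting the eventual value c leaves a finite sum, with no tail of
state probabilities to control. -/
theorem stateMean_eq_add_sum (h : SolvesForward Q X α lam μ ξ i) {φ : ℕ → ℝ} {N : ℕ} {c : ℝ}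
    (hφ : ∀ n, N ≤ n → φ n = c) (t : ℝ) :
    stateMean Q X φ t = c + ∑ n ∈ Finset.range N, (φ n - c) * stateProb Q X n t := by
  rw [← h.stateMean_eq_sum (ψ := fun n => φ n - c) (fun n hn => sub_eq_zero.2 (hφ n hn)) t]
  rw [stateMean, stateMean, integral_sub (h.integrable_of_eventually_const hφ _) (integrable_const c)]
  simp

theorem continuous_stateMean (h : SolvesForward Q X α lam μ ξ i) {φ : ℕ → ℝ} {N : ℕ} {c : ℝ}
    (hφ : ∀ n, N ≤ n → φ n = c) : Continuous (stateMean Q X φ) := by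
  rw [show stateMean Q X φ = _ from funext (h.stateMean_eq_add_sum hφ)]
  have := h.continuous
  fun_prop

/-- After subtracting φ N the test function has finite support, so the boundary terms of the
summation by parts vanish. The sum runs to N + 1 because the generator looks one state up and down.
-/
theorem stateMean_eq_add_fracIntegral_of_eventually_const (h : SolvesForward Q X α lam μ ξ i)
    (hα : 0 < α) {φ : ℕ → ℝ} {N : ℕ} (hφ : ∀ n, N ≤ n → φ n = φ N) {t : ℝ} (ht : 0 ≤ t) :
    stateMean Q X φ t
      = φ i + fracIntegral α (stateMean Q X (queueGenerator lam μ ξ φ)) t := by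
  set ψ : ℕ → ℝ := fun n => φ n - φ N with hψ_def
  have hψ : ∀ n, N ≤ n → ψ n = 0 := fun n hn => sub_eq_zero.2 (hφ n hn)
  have hgen : queueGenerator lam μ ξ φ = queueGenerator lam μ ξ ψ := by
    funext n
    simp only [queueGenerator, hψ_def]
    ring
  have hgen_const : ∀ n, N + 1 ≤ n → queueGenerator lam μ ξ ψ n = ξ * ψ 0 := fun n hn => by
    simp only [queueGenerator]
    rw [hψ n (by omega), hψ (n + 1) (by omega), hψ (n - 1) (by omega)]
    ring
  have hrate : ∀ s, ∑ n ∈ Finset.range (N + 1), ψ n * forwardRate lam μ ξ (stateProb Q X) n s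
      = stateMean Q X (queueGenerator lam μ ξ ψ) s := fun s => by
    rw [sum_mul_forwardRate, h.stateMean_eq_add_sum hgen_const, hψ N le_rfl, hψ (N + 1) (by omega)]
    ring
  rw [h.stateMean_eq_add_sum (N := N + 1) (c := φ N) (fun n hn => hφ n (by omega)) t, hgen]
  simp_rw [h.eq_add _ t ht, mul_add]
  rw [Finset.sum_add_distrib,
    sum_range_ite_of_eq_zero (ψ := ψ) (N := N + 1) (fun n hn => hψ n (by omega)) i,
    sum_mul_fracIntegral _ ψ h.continuous_forwardRate hα.le ht]
  simp_rw [hrate]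
  simp only [hψ_def]
  ring

/-- A truncated square is monotone, so services and catastrophes contribute nonpositively to the
generator and only arrivals count. The resulting Grönwall constants do not involve N. -/
theorem exists_stateMean_sq_min_le (h : SolvesForward Q X α lam μ ξ i) (hα : 0 < α)
    (hlam : 0 ≤ lam) (hμ : 0 ≤ μ) (hξ : 0 ≤ ξ) (T : ℝ) :
    ∃ C : ℝ, 0 ≤ C ∧ ∀ t ∈ Icc 0 T, ∀ N : ℕ,
      stateMean Q X (fun n => ((min n N : ℕ) : ℝ) ^ 2) t ≤ C := by
  have hG : 0 < Real.Gamma (α + 1) := Real.Gamma_pos_of_pos (by linarith)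
  set a : ℝ := (i : ℝ) ^ 2 + lam * (|T| ^ α / Real.Gamma (α + 1)) with ha_def
  have ha : 0 ≤ a := by positivity
  set C := a * ∑' k : ℕ, (2 * lam * T ^ α) ^ k / Real.Gamma (α * k + 1)
  -- For negative T the sign of C is unclear, but the time interval is then empty.
  refine ⟨max C 0, le_max_right _ _, fun t ht N => le_trans ?_ (le_max_left _ _)⟩
  set φ : ℕ → ℝ := fun n => ((min n N : ℕ) : ℝ) ^ 2 with hφ_def
  have hφ : ∀ n, N ≤ n → φ n = φ N := fun n hn => by simp [hφ_def, hn]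
  have hcont := h.continuous_stateMean hφ
  have hgen_const : ∀ n, N + 1 ≤ n → queueGenerator lam μ ξ φ n = ξ * (φ 0 - φ N) := fun n hn => by
    simp only [queueGenerator]
    rw [hφ n (by omega), hφ (n + 1) (by omega), hφ (n - 1) (by omega)]
    ring
  have hmono : Monotone φ := fun m n hmn => by
    simp only [hφ_def]
    gcongr
  have hgen_le : ∀ n, queueGenerator lam μ ξ φ n ≤ lam + 2 * lam * φ n := fun n => by
    have h1 : φ (n + 1) - φ n ≤ 1 + 2 * φ n := by
      rcases lt_or_ge n N with hn | hn
      · have e1 : φ (n + 1) = ((n : ℝ) + 1) ^ 2 := by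
          simp only [hφ_def]
          rw [min_eq_left (by omega)]
          push_cast
          rfl
        have e2 : φ n = (n : ℝ) ^ 2 := by
          simp only [hφ_def]
          rw [min_eq_left hn.le]
        -- For natural n this turns the increment 2n + 1 into at most 1 + 2n².
        have e3 : (n : ℝ) ≤ (n : ℝ) ^ 2 := by exact_mod_cast Nat.le_self_pow two_ne_zero n
        rw [e1, e2]
        linarith
      · rw [hφ (n + 1) (by omega), hφ n hn]
        have : 0 ≤ φ N := sq_nonneg _
        linarith
    have h2 : φ (n - 1) - φ n ≤ 0 := sub_nonpos.2 (hmono (Nat.sub_le n 1))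
    have h3 : φ 0 - φ n ≤ 0 := sub_nonpos.2 (hmono (Nat.zero_le n))
    have h4 := mul_le_mul_of_nonneg_left h1 hlam
    have h5 := mul_nonpos_of_nonneg_of_nonpos hμ h2
    have h6 := mul_nonpos_of_nonneg_of_nonpos hξ h3
    unfold queueGenerator
    linarith
  have hu := MeasurableLocallyBounded.of_continuous hcont
  have hgen_mean : ∀ s, stateMean Q X (queueGenerator lam μ ξ φ) s
      ≤ lam + 2 * lam * stateMean Q X φ s := fun s => by
    have hi1 := h.integrable_of_eventually_const hφ s.toNNReal
    have hi2 := h.integrable_of_eventually_const hgen_const s.toNNReal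
    have h1 : ∫ ω, (lam + 2 * lam * φ (X s.toNNReal ω)) ∂Q = lam + 2 * lam * stateMean Q X φ s := by
      rw [integral_add (integrable_const _) (hi1.const_mul _), integral_const_mul]
      simp [stateMean]
    rw [← h1]
    exact integral_mono hi2 ((integrable_const _).add (hi1.const_mul _)) fun ω => hgen_le _
  refine le_mul_tsum_of_le_add_fracIntegral hu hα ha (by positivity) (fun s hs => ?_) ht
  rw [h.stateMean_eq_add_fracIntegral_of_eventually_const hα hφ hs.1]
  have h1 := fracIntegral_mono
    (.of_continuous (h.continuous_stateMean hgen_const))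
    ((MeasurableLocallyBounded.const lam).add (hu.const_mul (2 * lam))) hα.le hs.1
    fun x _ => hgen_mean x
  rw [fracIntegral_add (.const lam) (hu.const_mul _) hα.le hs.1, fracIntegral_const hα.le,
    fracIntegral_const_mul] at h1
  have h2 : φ i ≤ (i : ℝ) ^ 2 := by
    simp only [hφ_def]
    gcongr
    exact min_le_left _ _
  have h3 : s ^ α ≤ |T| ^ α := Real.rpow_le_rpow hs.1 (hs.2.trans (le_abs_self T)) hα.le
  have h4 : lam * (s ^ α / Real.Gamma (α + 1)) ≤ lam * (|T| ^ α / Real.Gamma (α + 1)) := by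
    gcongr
  rw [ha_def]
  linarith

end SolvesForward
end StateMean

/-! ### Second moments and Dynkin's formula for quadratic growth. -/

theorem abs_queueGenerator_le {lam μ ξ C : ℝ} (hlam : 0 ≤ lam) (hμ : 0 ≤ μ) (hξ : 0 ≤ ξ)
    {φ : ℕ → ℝ} {n : ℕ} (hφ : ∀ m ≤ n + 1, |φ m| ≤ C) :
    |queueGenerator lam μ ξ φ n| ≤ 2 * (lam + μ + ξ) * C := by
  have h : ∀ m ≤ n + 1, |φ m - φ n| ≤ 2 * C := fun m hm => by
    have h1 := abs_sub (φ m) (φ n)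
    have h2 := hφ m hm
    have h3 := hφ n (by omega)
    linarith
  unfold queueGenerator
  refine (abs_add_three _ _ _).trans ?_
  rw [abs_mul, abs_mul, abs_mul, abs_of_nonneg hlam, abs_of_nonneg hμ, abs_of_nonneg hξ]
  have h1 := mul_le_mul_of_nonneg_left (h (n + 1) le_rfl) hlam
  have h2 := mul_le_mul_of_nonneg_left (h (n - 1) (by omega)) hμ
  have h3 := mul_le_mul_of_nonneg_left (h 0 (by omega)) hξ
  linarith

namespace SolvesForward

variable {Ω : Type*} [MeasurableSpace Ω] {Q : Measure Ω} [IsProbabilityMeasure Q]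
  {X : ℝ≥0 → Ω → ℕ} {α lam μ ξ : ℝ} {i : ℕ}

/-- Fatou's lemma along the truncations N → ∞, whose means are bounded uniformly in N. -/
theorem exists_lintegral_sq_le (h : SolvesForward Q X α lam μ ξ i) (hα : 0 < α)
    (hlam : 0 ≤ lam) (hμ : 0 ≤ μ) (hξ : 0 ≤ ξ) (T : ℝ) :
    ∃ C : ℝ, 0 ≤ C ∧ ∀ t ∈ Icc 0 T,
      ∫⁻ ω, ENNReal.ofReal ((X t.toNNReal ω : ℝ) ^ 2) ∂Q ≤ ENNReal.ofReal C := by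
  obtain ⟨C, hC, hle⟩ := h.exists_stateMean_sq_min_le hα hlam hμ hξ T
  refine ⟨C, hC, fun t ht => ?_⟩
  have hbound : ∀ N : ℕ, ∫⁻ ω, ENNReal.ofReal (((min (X t.toNNReal ω) N : ℕ) : ℝ) ^ 2) ∂Q
      ≤ ENNReal.ofReal C := fun N => by
    have hint := h.integrable_of_eventually_const (φ := fun n => ((min n N : ℕ) : ℝ) ^ 2)
      (N := N) (c := (N : ℝ) ^ 2) (fun n hn => by simp [hn]) t.toNNReal
    rw [← ofReal_integral_eq_lintegral_ofReal hint
      (Filter.Eventually.of_forall fun ω => sq_nonneg _)]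
    exact ENNReal.ofReal_le_ofReal (hle t ht N)
  have hlim : ∀ ω, ENNReal.ofReal ((X t.toNNReal ω : ℝ) ^ 2) = Filter.liminf (fun N : ℕ =>
      ENNReal.ofReal (((min (X t.toNNReal ω) N : ℕ) : ℝ) ^ 2)) Filter.atTop := fun ω => by
    refine (Filter.Tendsto.liminf_eq (tendsto_const_nhds.congr' ?_)).symm
    filter_upwards [Filter.eventually_ge_atTop (X t.toNNReal ω)] with N hN
    rw [min_eq_left hN]
  simp_rw [hlim]
  refine (lintegral_liminf_le fun N =>
    (h.measurable_comp (fun n => ((min n N : ℕ) : ℝ) ^ 2) _).ennreal_ofReal).trans ?_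
  exact (Filter.liminf_le_liminf (Filter.Eventually.of_forall hbound)).trans_eq
    (Filter.liminf_const _)

theorem integrable_sq (h : SolvesForward Q X α lam μ ξ i) (hα : 0 < α)
    (hlam : 0 ≤ lam) (hμ : 0 ≤ μ) (hξ : 0 ≤ ξ) (t : ℝ≥0) :
    Integrable (fun ω => (X t ω : ℝ) ^ 2) Q := by
  obtain ⟨C, -, hle⟩ := h.exists_lintegral_sq_le hα hlam hμ hξ t
  refine ⟨(h.measurable_comp (fun n => (n : ℝ) ^ 2) t).aestronglyMeasurable, ?_⟩
  rw [hasFiniteIntegral_iff_ofReal (Filter.Eventually.of_forall fun ω => sq_nonneg _)]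
  have := hle t ⟨t.coe_nonneg, le_rfl⟩
  rw [Real.toNNReal_coe] at this
  exact this.trans_lt ENNReal.ofReal_lt_top

theorem integrable_of_abs_le (h : SolvesForward Q X α lam μ ξ i) (hα : 0 < α)
    (hlam : 0 ≤ lam) (hμ : 0 ≤ μ) (hξ : 0 ≤ ξ) {φ : ℕ → ℝ} {C : ℝ}
    (hφ : ∀ n, |φ n| ≤ C * (1 + (n : ℝ) ^ 2)) (t : ℝ≥0) : Integrable (fun ω => φ (X t ω)) Q :=
  Integrable.mono' (((integrable_const 1).add (h.integrable_sq hα hlam hμ hξ t)).const_mul C)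
    (h.measurable_comp φ t).aestronglyMeasurable (Filter.Eventually.of_forall fun _ => hφ _)

theorem exists_abs_stateMean_le (h : SolvesForward Q X α lam μ ξ i) (hα : 0 < α)
    (hlam : 0 ≤ lam) (hμ : 0 ≤ μ) (hξ : 0 ≤ ξ) {C : ℝ} (hC : 0 ≤ C) (T : ℝ) :
    ∃ D : ℝ, 0 ≤ D ∧ ∀ φ : ℕ → ℝ, (∀ n, |φ n| ≤ C * (1 + (n : ℝ) ^ 2)) →
      ∀ t ∈ Icc 0 T, |stateMean Q X φ t| ≤ D := by
  obtain ⟨B, hB, hle⟩ := h.exists_lintegral_sq_le hα hlam hμ hξ T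
  refine ⟨C * (1 + B), by positivity, fun φ hφ t ht => ?_⟩
  have hsq := h.integrable_sq hα hlam hμ hξ t.toNNReal
  have hmean : ∫ ω, (X t.toNNReal ω : ℝ) ^ 2 ∂Q ≤ B := by
    rw [← ENNReal.ofReal_le_ofReal_iff hB, ofReal_integral_eq_lintegral_ofReal hsq
      (Filter.Eventually.of_forall fun ω => sq_nonneg _)]
    exact hle t ht
  have hint : Integrable (fun ω => C * (1 + (X t.toNNReal ω : ℝ) ^ 2)) Q :=
    ((integrable_const 1).add hsq).const_mul C
  calc |stateMean Q X φ t| ≤ ∫ ω, C * (1 + (X t.toNNReal ω : ℝ) ^ 2) ∂Q :=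
        norm_integral_le_of_norm_le (f := fun ω => φ (X t.toNNReal ω)) hint (Filter.Eventually.of_forall fun _ => hφ _)
    _ = C * (1 + ∫ ω, (X t.toNNReal ω : ℝ) ^ 2 ∂Q) := by
        rw [integral_const_mul, integral_add (integrable_const 1) hsq]
        simp
    _ ≤ C * (1 + B) := by gcongr

/-- Dominated convergence, with the finite second moment as majorant. Agreement is asked only for n
+ 1 ≤ N, since the generator of a truncation also sees the state n + 1. -/
theorem tendsto_stateMean (h : SolvesForward Q X α lam μ ξ i) (hα : 0 < α)
    (hlam : 0 ≤ lam) (hμ : 0 ≤ μ) (hξ : 0 ≤ ξ) {φ : ℕ → ℕ → ℝ} {χ : ℕ → ℝ} {C : ℝ}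
    (hφ : ∀ N n, |φ N n| ≤ C * (1 + (n : ℝ) ^ 2)) (hlim : ∀ n N, n + 1 ≤ N → φ N n = χ n) (t : ℝ) :
    Filter.Tendsto (fun N => stateMean Q X (φ N) t) Filter.atTop (nhds (stateMean Q X χ t)) := by
  refine tendsto_integral_of_dominated_convergence
    (fun ω => C * (1 + (X t.toNNReal ω : ℝ) ^ 2))
    (fun N => (h.measurable_comp (φ N) _).aestronglyMeasurable)
    (((integrable_const 1).add (h.integrable_sq hα hlam hμ hξ _)).const_mul C)
    (fun N => Filter.Eventually.of_forall fun ω => hφ N _)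
    (Filter.Eventually.of_forall fun ω => tendsto_const_nhds.congr' ?_)
  filter_upwards [Filter.eventually_ge_atTop (X t.toNNReal ω + 1)] with N hN
  exact (hlim _ _ hN).symm

theorem abs_comp_min_le {φ : ℕ → ℝ} {C : ℝ} (hC : 0 ≤ C)
    (hφ : ∀ n, |φ n| ≤ C * (1 + (n : ℝ) ^ 2)) (N n : ℕ) :
    |φ (min n N)| ≤ C * (1 + (n : ℝ) ^ 2) := by
  refine (hφ _).trans ?_
  have : ((min n N : ℕ) : ℝ) ≤ n := by exact_mod_cast min_le_left n N
  gcongr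

/-- The mean is a pointwise limit of continuous means of truncations, hence measurable. The
fractional calculus above needs no more, so continuity of the moments is never required. -/
theorem measurableLocallyBounded_stateMean (h : SolvesForward Q X α lam μ ξ i) (hα : 0 < α)
    (hlam : 0 ≤ lam) (hμ : 0 ≤ μ) (hξ : 0 ≤ ξ) {φ : ℕ → ℝ} {C : ℝ} (hC : 0 ≤ C)
    (hφ : ∀ n, |φ n| ≤ C * (1 + (n : ℝ) ^ 2)) : MeasurableLocallyBounded (stateMean Q X φ) := by
  constructor
  · refine measurable_of_tendsto_metrizable (f := fun N => stateMean Q X fun n => φ (min n N))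
      (fun N => (h.continuous_stateMean (N := N) (c := φ N) fun n hn => by
        rw [min_eq_right hn]).measurable) ?_
    rw [tendsto_pi_nhds]
    exact h.tendsto_stateMean hα hlam hμ hξ (fun N n => abs_comp_min_le hC hφ N n)
      fun n N hN => by rw [min_eq_left (by omega)]
  · intro T
    obtain ⟨D, hD, hle⟩ := h.exists_abs_stateMean_le hα hlam hμ hξ hC T
    exact ⟨D, hD, hle φ hφ⟩

/-- Dynkin's formula for functions of at most quadratic growth. -/
theorem stateMean_eq_add_fracIntegral (h : SolvesForward Q X α lam μ ξ i) (hα : 0 < α)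
    (hlam : 0 ≤ lam) (hμ : 0 ≤ μ) (hξ : 0 ≤ ξ) {φ : ℕ → ℝ} {C : ℝ} (hC : 0 ≤ C)
    (hφ : ∀ n, |φ n| ≤ C * (1 + (n : ℝ) ^ 2)) {t : ℝ} (ht : 0 ≤ t) :
    stateMean Q X φ t = φ i + fracIntegral α (stateMean Q X (queueGenerator lam μ ξ φ)) t := by
  have hgen : ∀ N n, |queueGenerator lam μ ξ (fun n => φ (min n N)) n|
      ≤ 2 * (lam + μ + ξ) * (3 * C) * (1 + (n : ℝ) ^ 2) := fun N n => by
    refine (abs_queueGenerator_le (C := 3 * C * (1 + (n : ℝ) ^ 2)) hlam hμ hξ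
      fun m hm => ?_).trans_eq (by ring)
    refine (abs_comp_min_le hC hφ N m).trans ?_
    have hm' : (m : ℝ) ≤ n + 1 := by exact_mod_cast hm
    have h1 : (m : ℝ) ^ 2 ≤ (n + 1) ^ 2 := by gcongr
    -- Source of the factor 3: 1 + (n + 1)² ≤ 3 (1 + n²), because (n - 1)² ≥ 0.
    have h2 : 1 + (m : ℝ) ^ 2 ≤ 3 * (1 + (n : ℝ) ^ 2) := by nlinarith [sq_nonneg ((n : ℝ) - 1)]
    exact (mul_le_mul_of_nonneg_left h2 hC).trans_eq (by ring)
  have hgen_lim : ∀ n N, n + 1 ≤ N → queueGenerator lam μ ξ (fun n => φ (min n N)) n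
      = queueGenerator lam μ ξ φ n := fun n N hN => by
    simp only [queueGenerator]
    rw [min_eq_left (by omega), min_eq_left (by omega), min_eq_left (by omega),
      min_eq_left (by omega)]
  have hconst : ∀ N n, N ≤ n → φ (min n N) = φ N := fun N n hn => by rw [min_eq_right hn]
  have hC' : 0 ≤ 2 * (lam + μ + ξ) * (3 * C) := by positivity
  have hgen_meas : ∀ N, MeasurableLocallyBounded
      (stateMean Q X (queueGenerator lam μ ξ fun n => φ (min n N))) := fun N =>
    h.measurableLocallyBounded_stateMean hα hlam hμ hξ hC' (hgen N)
  obtain ⟨D, hD, hle⟩ := h.exists_abs_stateMean_le hα hlam hμ hξ hC' t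
  have hlim1 := h.tendsto_stateMean hα hlam hμ hξ (φ := fun N n => φ (min n N)) (χ := φ)
    (fun N n => abs_comp_min_le hC hφ N n) (fun n N hN => by rw [min_eq_left (by omega)]) t
  have hlim2 : Filter.Tendsto (fun N => fracIntegral α
      (stateMean Q X (queueGenerator lam μ ξ fun n => φ (min n N))) t) Filter.atTop
      (nhds (fracIntegral α (stateMean Q X (queueGenerator lam μ ξ φ)) t)) := by
    simp_rw [fracIntegral_of_pos hα]
    refine Filter.Tendsto.const_mul _ ?_
    refine intervalIntegral.tendsto_integral_filter_of_dominated_convergence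
      (fun s => (t - s) ^ (α - 1) * D) ?_ ?_ ?_ ?_
    · refine Filter.Eventually.of_forall fun N => Measurable.aestronglyMeasurable ?_
      exact ((measurable_const.sub measurable_id).pow_const _).mul (hgen_meas N).measurable
    · refine Filter.Eventually.of_forall fun N => Filter.Eventually.of_forall fun s hs => ?_
      rw [uIoc_of_le ht] at hs
      have h0 := Real.rpow_nonneg (sub_nonneg.2 hs.2) (α - 1)
      rw [norm_mul, Real.norm_of_nonneg h0]
      exact mul_le_mul_of_nonneg_left (hle _ (hgen N) s ⟨hs.1.le, hs.2⟩) h0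
    · exact (intervalIntegrable_sub_rpow hα t).mul_const D
    · refine Filter.Eventually.of_forall fun s _ => Filter.Tendsto.const_mul _ ?_
      exact h.tendsto_stateMean hα hlam hμ hξ hgen hgen_lim s
  have hlim3 : Filter.Tendsto (fun N => φ (min i N)) Filter.atTop (nhds (φ i)) := by
    refine tendsto_const_nhds.congr' ?_
    filter_upwards [Filter.eventually_ge_atTop i] with N hN
    rw [min_eq_left hN]
  refine tendsto_nhds_unique hlim1 ((hlim3.add hlim2).congr fun N => ?_)
  exact (h.stateMean_eq_add_fracIntegral_of_eventually_const hα (φ := fun n => φ (min n N))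
    (N := N) (fun n hn => by simp only [hconst N n hn, min_self]) ht).symm

/-! ### Integral equations for the first two moments. -/

theorem abs_cast_le (n : ℕ) : |(n : ℝ)| ≤ 1 * (1 + (n : ℝ) ^ 2) := by
  rw [Nat.abs_cast]
  nlinarith [sq_nonneg ((n : ℝ) - 1)]

theorem abs_cast_sq_le (n : ℕ) : |(n : ℝ) ^ 2| ≤ 1 * (1 + (n : ℝ) ^ 2) := by
  rw [abs_of_nonneg (sq_nonneg _)]
  linarith

/-- The generator maps n and n² into the span of 1, 1_{n=0}, n and n², which is why the moment
system closes up to P_{i,0}. -/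
theorem stateMean_quadratic (h : SolvesForward Q X α lam μ ξ i) (hα : 0 < α)
    (hlam : 0 ≤ lam) (hμ : 0 ≤ μ) (hξ : 0 ≤ ξ) (a b c d s : ℝ) :
    stateMean Q X (fun n => a + b * (if n = 0 then (1 : ℝ) else 0) + (c * n + d * (n : ℝ) ^ 2)) s
      = a + b * stateProb Q X 0 s + (c * stateMean Q X (fun n => (n : ℝ)) s
        + d * stateMean Q X (fun n => (n : ℝ) ^ 2) s) := by
  have hz : ∀ n : ℕ, 1 ≤ n → (if n = 0 then (1 : ℝ) else 0) = 0 := fun n hn => if_neg (by omega)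
  have hz_mean := h.stateMean_eq_sum hz s
  simp only [Finset.range_one, Finset.sum_singleton, if_true, one_mul] at hz_mean
  have hi1 := (h.integrable_of_eventually_const hz s.toNNReal).const_mul b
  have hi2 := (h.integrable_of_abs_le hα hlam hμ hξ abs_cast_le s.toNNReal).const_mul c
  have hi3 := (h.integrable_sq hα hlam hμ hξ s.toNNReal).const_mul d
  have hA : Integrable (fun ω => a + b * (if X s.toNNReal ω = 0 then (1 : ℝ) else 0)) Q :=
    (integrable_const a).add hi1
  have hB : Integrable (fun ω => c * (X s.toNNReal ω : ℝ) + d * (X s.toNNReal ω : ℝ) ^ 2) Q :=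
    hi2.add hi3
  rw [← hz_mean]
  simp only [stateMean]
  rw [integral_add hA hB, integral_add (integrable_const a) hi1, integral_add hi2 hi3,
    integral_const_mul, integral_const_mul, integral_const_mul]
  simp

theorem stateMean_cast_eq (h : SolvesForward Q X α lam μ ξ i) (hα : 0 < α)
    (hlam : 0 ≤ lam) (hμ : 0 ≤ μ) (hξ : 0 ≤ ξ) {t : ℝ} (ht : 0 ≤ t) :
    stateMean Q X (fun n => (n : ℝ)) t
      = (i + fracIntegral α (fun s => lam - μ + μ * stateProb Q X 0 s) t)
        + -ξ * fracIntegral α (stateMean Q X fun n => (n : ℝ)) t := by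
  have hm := h.measurableLocallyBounded_stateMean hα hlam hμ hξ zero_le_one abs_cast_le
  have hp := MeasurableLocallyBounded.of_continuous (h.continuous 0)
  rw [h.stateMean_eq_add_fracIntegral hα hlam hμ hξ zero_le_one abs_cast_le ht, add_assoc,
    ← fracIntegral_const_mul, ← fracIntegral_add ((MeasurableLocallyBounded.const _).add
      (hp.const_mul μ)) (hm.const_mul _) hα.le ht]
  congr 2
  funext s
  -- In state 0 no service occurs, which accounts for the correction μ 1_{n=0}.
  have hgen : queueGenerator lam μ ξ (fun n => (n : ℝ)) = fun n : ℕ =>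
      lam - μ + μ * (if n = 0 then (1 : ℝ) else 0) + (-ξ * n + 0 * (n : ℝ) ^ 2) := by
    funext n
    rcases n with _ | n
    · simp [queueGenerator]
    · simp [queueGenerator]
      ring
  rw [hgen, h.stateMean_quadratic hα hlam hμ hξ]
  ring

theorem stateMean_sq_eq (h : SolvesForward Q X α lam μ ξ i) (hα : 0 < α)
    (hlam : 0 ≤ lam) (hμ : 0 ≤ μ) (hξ : 0 ≤ ξ) {t : ℝ} (ht : 0 ≤ t) :
    stateMean Q X (fun n => (n : ℝ) ^ 2) t
      = ((i : ℝ) ^ 2 + fracIntegral α (fun s => lam + μ + -μ * stateProb Q X 0 s) t)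
        + 2 * (lam - μ) * fracIntegral α (stateMean Q X fun n => (n : ℝ)) t
        + -ξ * fracIntegral α (stateMean Q X fun n => (n : ℝ) ^ 2) t := by
  have hm1 := h.measurableLocallyBounded_stateMean hα hlam hμ hξ zero_le_one abs_cast_le
  have hm := h.measurableLocallyBounded_stateMean hα hlam hμ hξ zero_le_one abs_cast_sq_le
  have hp := MeasurableLocallyBounded.of_continuous (h.continuous 0)
  have hp' := (MeasurableLocallyBounded.const (lam + μ)).add (hp.const_mul (-μ))
  rw [h.stateMean_eq_add_fracIntegral hα hlam hμ hξ zero_le_one abs_cast_sq_le ht, add_assoc, add_assoc,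
    ← fracIntegral_const_mul, ← fracIntegral_const_mul α (-ξ),
    ← fracIntegral_add (hm1.const_mul _) (hm.const_mul _) hα.le ht,
    ← fracIntegral_add hp' ((hm1.const_mul _).add (hm.const_mul _)) hα.le ht]
  congr 2
  funext s
  have hgen : queueGenerator lam μ ξ (fun n => (n : ℝ) ^ 2) = fun n : ℕ =>
      lam + μ + -μ * (if n = 0 then (1 : ℝ) else 0)
        + (2 * (lam - μ) * n + -ξ * (n : ℝ) ^ 2) := by
    funext n
    rcases n with _ | n
    · simp [queueGenerator]
    · simp [queueGenerator]
      ring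
  rw [hgen, h.stateMean_quadratic hα hlam hμ hξ]

end SolvesForward

theorem IsFractionalQueue.solvesForward {Ω : Type*} [MeasurableSpace Ω] {P : Measure Ω}
    {α lam μ ξ : ℝ} {X : ℝ≥0 → Ω → ℕ} (hX : IsFractionalQueue P α lam μ ξ X) (hα0 : 0 < α)
    (hα1 : α ≤ 1) {i : ℕ} (hi : P (X 0 ⁻¹' {i}) ≠ 0) :
    SolvesForward (cond P (X 0 ⁻¹' {i})) X α lam μ ξ i := by
  -- `Real.toNNReal` sends negative times to 0, so continuity on t ≥ 0 extends to the whole line.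
  have hcont : ∀ n, Continuous (transitionProb P X i n) := fun n => by
    have h1 : Continuous fun t : ℝ => transitionProb P X i n (max t 0) :=
      (hX.continuousOn i n hi).comp_continuous (by fun_prop) fun t => mem_Ici.2 (le_max_right t 0)
    refine h1.congr fun t => ?_
    rcases le_total t 0 with h | h
    · simp [transitionProb, max_eq_right h, Real.toNNReal_of_nonpos h]
    · rw [max_eq_left h]
  refine ⟨hX.measurable, hcont, fun n t ht => ?_⟩
  have hrate : Continuous (forwardRate lam μ ξ (transitionProb P X i) n) := by
    cases n <;> unfold forwardRate <;> fun_prop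
  have hmain := eq_add_fracIntegral_of_hasCaputoDerivAt hα0 hα1 (hcont n) hrate (fun s hs => by
    cases n with
    | zero => exact hX.forward_zero i hi s hs
    | succ n => exact hX.forward_pos i (n + 1) (by omega) hi s hs) ht
  rw [hX.init i n hi] at hmain
  exact hmain

/-! ### Identification of the series with Mittag-Leffler functions and convolutions. -/

theorem mittagLeffler_one (β γ w : ℝ) :
    mittagLeffler 1 β γ w = ∑' k : ℕ, w ^ k / Real.Gamma (β * k + γ) := by
  refine tsum_congr fun k => ?_
  have : (Nat.factorial k : ℝ) ≠ 0 := by positivity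
  rw [add_comm (1 : ℝ), Real.Gamma_nat_eq_factorial, Real.Gamma_one, mul_one,
    mul_comm (w ^ k), mul_div_mul_left _ _ this]

theorem mittagLeffler_two (β γ w : ℝ) :
    mittagLeffler 2 β γ w = ∑' k : ℕ, ((k : ℝ) + 1) * w ^ k / Real.Gamma (β * k + γ) := by
  refine tsum_congr fun k => ?_
  have h1 : (Nat.factorial k : ℝ) ≠ 0 := by positivity
  have h2 : Real.Gamma (2 + k) = (k + 1) * Nat.factorial k := by
    have := Real.Gamma_nat_eq_factorial (k + 1)
    rw [Nat.factorial_succ] at this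
    push_cast at this
    rw [← this]
    congr 1
    ring
  have h3 : Real.Gamma 2 = 1 := by simp
  rw [h2, h3, mul_one, show w ^ k * ((k + 1) * (Nat.factorial k : ℝ))
    = Nat.factorial k * ((k + 1) * w ^ k) by ring, mul_div_mul_left _ _ h1]

theorem one_add_mul_mittagLeffler_one {α : ℝ} (hα : 0 < α) (w : ℝ) :
    mittagLeffler 1 α 1 w = 1 + w * mittagLeffler 1 α (α + 1) w := by
  rw [mittagLeffler_one, mittagLeffler_one,
    (summable_pow_div_Gamma hα zero_le_one w).tsum_eq_zero_add, ← tsum_mul_left]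
  congr 1
  · simp
  · refine tsum_congr fun k => ?_
    have : α * ((k + 1 : ℕ) : ℝ) + 1 = α * k + (α + 1) := by push_cast; ring
    rw [this, pow_succ]
    ring

theorem rpow_mul_natCast_add {α γ t : ℝ} (hα : 0 ≤ α) (hγ : 0 ≤ γ) (ht : 0 ≤ t) (k : ℕ) :
    t ^ (α * k + γ) = (t ^ α) ^ k * t ^ γ := by
  rw [Real.rpow_add_of_nonneg ht (by positivity) hγ, Real.rpow_mul ht, Real.rpow_natCast]

theorem hasSum_rpow_mul_mittagLeffler_one {α γ t : ℝ} (hα : 0 < α) (hγ : 0 ≤ γ) (ht : 0 ≤ t)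
    (c : ℝ) : HasSum (fun k : ℕ => c ^ k * (t ^ (α * k + γ) / Real.Gamma (α * k + γ + 1)))
      (t ^ γ * mittagLeffler 1 α (γ + 1) (c * t ^ α)) := by
  rw [mittagLeffler_one]
  refine ((summable_pow_div_Gamma hα (by linarith) _).hasSum.mul_left _).congr_fun fun k => ?_
  rw [rpow_mul_natCast_add hα.le hγ ht, mul_pow, add_assoc]
  ring

theorem hasSum_rpow_mul_mittagLeffler_two {α γ t : ℝ} (hα : 0 < α) (hγ : 0 ≤ γ) (ht : 0 ≤ t)
    (c : ℝ) : HasSum (fun k : ℕ =>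
      ((k : ℝ) + 1) * c ^ k * (t ^ (α * k + γ) / Real.Gamma (α * k + γ + 1)))
      (t ^ γ * mittagLeffler 2 α (γ + 1) (c * t ^ α)) := by
  rw [mittagLeffler_two]
  refine ((summable_succ_mul_pow_div_Gamma hα (by linarith) _).hasSum.mul_left _).congr_fun
    fun k => ?_
  rw [rpow_mul_natCast_add hα.le hγ ht, mul_pow, add_assoc]
  ring

/-- Termwise integration of a convolution with a Mittag-Leffler type series. -/
theorem hasSum_mul_fracIntegral {p : ℝ → ℝ} (hp : MeasurableLocallyBounded p) {α γ t : ℝ}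
    (hα : 0 < α) (hγ : 0 < γ) (ht : 0 ≤ t) (c : ℝ) {w : ℕ → ℝ} (hw0 : ∀ k, 0 ≤ w k)
    (hw : ∀ k, w k ≤ k + 1) :
    HasSum (fun k : ℕ => w k * c ^ k * fracIntegral (α * k + γ) p t)
      (timeConv p (fun s => s ^ (γ - 1) *
        ∑' k : ℕ, w k * (c * s ^ α) ^ k / Real.Gamma (α * k + γ)) t) := by
  obtain ⟨C, hC, hpC⟩ := hp.bounded t
  have hγk : ∀ k : ℕ, 0 < α * k + γ := fun k => by positivity
  have hG : ∀ k : ℕ, 0 < Real.Gamma (α * k + γ) := fun k => Real.Gamma_pos_of_pos (hγk k)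
  have hsum := summable_succ_mul_pow_div_Gamma hα hγ.le (|c| * t ^ α)
  -- At u = t the real power of t - u = 0 need not split as a product; this null set is discarded.
  have hne : ∀ᵐ u : ℝ, u ≠ t := by simp [ae_iff]
  have hterm : ∀ (k : ℕ) (u : ℝ), u < t →
      w k * c ^ k * ((Real.Gamma (α * k + γ))⁻¹ * ((t - u) ^ (α * k + γ - 1) * p u))
        = p u * ((t - u) ^ (γ - 1) *
          (w k * (c * (t - u) ^ α) ^ k / Real.Gamma (α * k + γ))) := fun k u hu => by
    have hu' : 0 < t - u := sub_pos.2 hu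
    rw [add_sub_assoc, Real.rpow_add hu', Real.rpow_mul hu'.le, Real.rpow_natCast, mul_pow]
    ring
  have hmain := intervalIntegral.hasSum_integral_of_dominated_convergence
    (μ := volume) (a := 0) (b := t)
    (F := fun (k : ℕ) u =>
      w k * c ^ k * ((Real.Gamma (α * k + γ))⁻¹ * ((t - u) ^ (α * k + γ - 1) * p u)))
    (f := fun u => p u * ((t - u) ^ (γ - 1) *
      ∑' k : ℕ, w k * (c * (t - u) ^ α) ^ k / Real.Gamma (α * k + γ)))
    (fun (k : ℕ) u => C * (t - u) ^ (γ - 1) *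
      (((k : ℝ) + 1) * (|c| * t ^ α) ^ k / Real.Gamma (α * k + γ))) ?_ ?_ ?_ ?_ ?_
  · refine hmain.congr_fun fun k => ?_
    rw [fracIntegral_of_pos (hγk k), intervalIntegral.integral_const_mul,
      intervalIntegral.integral_const_mul]
  · refine fun k => Measurable.aestronglyMeasurable ?_
    exact ((((measurable_const.sub measurable_id).pow_const _).mul hp.measurable).const_mul
      _).const_mul _
  · intro k
    filter_upwards [hne] with u hut hu
    rw [uIoc_of_le ht] at hu
    have hlt : u < t := lt_of_le_of_ne hu.2 hut
    have hpos : 0 < t - u := sub_pos.2 hlt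
    have hle : (t - u) ^ α ≤ t ^ α := Real.rpow_le_rpow hpos.le (by linarith [hu.1]) hα.le
    have h0 : 0 ≤ (t - u) ^ α := Real.rpow_nonneg hpos.le _
    have h1 : 0 ≤ (t - u) ^ (γ - 1) := Real.rpow_nonneg hpos.le _
    have h2 := hpC u ⟨hu.1.le, hu.2⟩
    have h3 := hG k
    have h4 := hw k
    have h5 := hw0 k
    rw [hterm k u hlt, norm_mul, norm_mul, norm_div, norm_mul, norm_pow, norm_mul,
      Real.norm_of_nonneg h0, Real.norm_of_nonneg h1, Real.norm_of_nonneg (hw0 k),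
      Real.norm_of_nonneg h3.le, Real.norm_eq_abs, Real.norm_eq_abs, mul_assoc]
    gcongr
  · exact Filter.Eventually.of_forall fun u _ => hsum.mul_left _
  · simp_rw [tsum_mul_left]
    exact ((intervalIntegrable_sub_rpow hγ t).const_mul C).mul_const _
  · filter_upwards [hne] with u hut hu
    rw [uIoc_of_le ht] at hu
    have hlt : u < t := lt_of_le_of_ne hu.2 hut
    have hs : Summable fun k : ℕ => w k * (c * (t - u) ^ α) ^ k / Real.Gamma (α * k + γ) := by
      refine Summable.of_norm_bounded
        (summable_succ_mul_pow_div_Gamma hα hγ.le |c * (t - u) ^ α|) fun k => ?_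
      have h3 := hG k
      have h4 := hw k
      rw [norm_div, norm_mul, norm_pow, Real.norm_of_nonneg (hw0 k), Real.norm_of_nonneg h3.le,
        Real.norm_eq_abs]
      gcongr
    exact ((hs.hasSum.mul_left _).mul_left _).congr_fun fun k => hterm k u hlt

theorem hasSum_mlConv_one {p : ℝ → ℝ} (hp : MeasurableLocallyBounded p) {α t : ℝ}
    (hα : 0 < α) (ht : 0 ≤ t) (ξ : ℝ) :
    HasSum (fun k : ℕ => (-ξ) ^ k * fracIntegral (α * k + α) p t) (mlConv α ξ 1 p t) := by
  have h := hasSum_mul_fracIntegral hp hα hα ht (-ξ) (w := fun _ => 1) (fun _ => zero_le_one)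
    fun k => by simp
  simpa only [one_mul, mlConv, mittagLeffler_one] using h

theorem hasSum_mlConv_two {p : ℝ → ℝ} (hp : MeasurableLocallyBounded p) {α t : ℝ}
    (hα : 0 < α) (ht : 0 ≤ t) (ξ : ℝ) :
    HasSum (fun k : ℕ => ((k : ℝ) + 1) * (-ξ) ^ k * fracIntegral (α * k + 2 * α) p t)
      (mlConv α ξ 2 p t) := by
  have h := hasSum_mul_fracIntegral hp hα (γ := 2 * α) (by linarith) ht (-ξ)
    (w := fun k => (k : ℝ) + 1) (fun k => by positivity) fun k => le_rfl
  simpa only [mlConv, mittagLeffler_two] using h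

theorem fracIntegral_const_add_fracIntegral {p : ℝ → ℝ} (hp : MeasurableLocallyBounded p)
    {α β t : ℝ} (hα : 0 ≤ α) (hβ : 0 ≤ β) (ht : 0 ≤ t) (A B b : ℝ) :
    fracIntegral β (fun s => A + fracIntegral α (fun x => B + b * p x) s) t
      = A * (t ^ β / Real.Gamma (β + 1)) + (B * (t ^ (β + α) / Real.Gamma (β + α + 1))
        + b * fracIntegral (β + α) p t) := by
  have hq := (MeasurableLocallyBounded.const B).add (hp.const_mul b)
  rw [fracIntegral_add (.const A) (hq.fracIntegral hα) hβ ht, fracIntegral_const hβ,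
    fracIntegral_fracIntegral hq hβ hα ht,
    fracIntegral_add (.const B) (hp.const_mul b) (add_nonneg hβ hα) ht,
    fracIntegral_const (add_nonneg hβ hα), fracIntegral_const_mul]

theorem MeasurableLocallyBounded.const_add_fracIntegral {p : ℝ → ℝ}
    (hp : MeasurableLocallyBounded p) {α : ℝ} (hα : 0 ≤ α) (A B b : ℝ) :
    MeasurableLocallyBounded (fun s => A + _root_.fracIntegral α (fun x => B + b * p x) s) :=
  (MeasurableLocallyBounded.const A).add
    (((MeasurableLocallyBounded.const B).add (hp.const_mul b)).fracIntegral hα)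

/-- Here A + J^α(B + b p) is the source term of a moment equation. J^{αk} sends constants to powers
of t, which sum to Mittag-Leffler functions, and p to the terms of the convolution. -/
theorem tsum_pow_mul_fracIntegral {p : ℝ → ℝ} (hp : MeasurableLocallyBounded p)
    {α t : ℝ} (hα : 0 < α) (ht : 0 ≤ t) (ξ A B b : ℝ) :
    ∑' k : ℕ, (-ξ) ^ k * fracIntegral (α * k)
        (fun s => A + fracIntegral α (fun x => B + b * p x) s) t
      = A * mittagLeffler 1 α 1 (-ξ * t ^ α) + B * (t ^ α * mittagLeffler 1 α (α + 1) (-ξ * t ^ α))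
        + b * mlConv α ξ 1 p t := by
  have h0 := (hasSum_rpow_mul_mittagLeffler_one hα le_rfl ht (-ξ)).mul_left A
  have h1 := (hasSum_rpow_mul_mittagLeffler_one hα hα.le ht (-ξ)).mul_left B
  have h2 := (hasSum_mlConv_one hp hα ht ξ).mul_left b
  simp only [add_zero, zero_add, Real.rpow_zero, one_mul] at h0
  refine (((h0.add h1).add h2).congr_fun fun k => ?_).tsum_eq
  rw [fracIntegral_const_add_fracIntegral hp hα.le (by positivity) ht]
  ring

theorem tsum_succ_mul_pow_mul_fracIntegral {p : ℝ → ℝ} (hp : MeasurableLocallyBounded p)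
    {α t : ℝ} (hα : 0 < α) (ht : 0 ≤ t) (ξ A B b : ℝ) :
    ∑' k : ℕ, ((k : ℝ) + 1) * (-ξ) ^ k * fracIntegral (α * k + α)
        (fun s => A + fracIntegral α (fun x => B + b * p x) s) t
      = A * (t ^ α * mittagLeffler 2 α (α + 1) (-ξ * t ^ α))
        + B * (t ^ (2 * α) * mittagLeffler 2 α (2 * α + 1) (-ξ * t ^ α))
        + b * mlConv α ξ 2 p t := by
  have h0 := (hasSum_rpow_mul_mittagLeffler_two hα hα.le ht (-ξ)).mul_left A
  have h1 := (hasSum_rpow_mul_mittagLeffler_two hα (γ := 2 * α) (by linarith) ht (-ξ)).mul_left B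
  have h2 := (hasSum_mlConv_two hp hα ht ξ).mul_left b
  refine (((h0.add h1).add h2).congr_fun fun k => ?_).tsum_eq
  rw [fracIntegral_const_add_fracIntegral hp hα.le (by positivity) ht,
    show α * k + α + α = α * k + 2 * α by ring]
  ring

/-! ### Closed forms of the moments and the variance. -/

namespace SolvesForward

variable {Ω : Type*} [MeasurableSpace Ω] {Q : Measure Ω} [IsProbabilityMeasure Q]
  {X : ℝ≥0 → Ω → ℕ} {α lam μ ξ : ℝ} {i : ℕ}

theorem stateMean_cast (h : SolvesForward Q X α lam μ ξ i) (hα : 0 < α)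
    (hlam : 0 ≤ lam) (hμ : 0 ≤ μ) (hξ : 0 ≤ ξ) {t : ℝ} (ht : 0 ≤ t) :
    stateMean Q X (fun n => (n : ℝ)) t = i * mittagLeffler 1 α 1 (-ξ * t ^ α)
      + (lam - μ) * (t ^ α * mittagLeffler 1 α (α + 1) (-ξ * t ^ α))
      + μ * mlConv α ξ 1 (stateProb Q X 0) t := by
  have hm := h.measurableLocallyBounded_stateMean hα hlam hμ hξ zero_le_one abs_cast_le
  have hp := MeasurableLocallyBounded.of_continuous (h.continuous 0)
  have hg := hp.const_add_fracIntegral hα.le i (lam - μ) μ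
  -- The scalar mean equation is the system with u = v and zero coupling d.
  rw [eq_tsum_of_eq_add_fracIntegral hm hm hg hg hα (c := -ξ) (d := 0)
    (fun s hs => h.stateMean_cast_eq hα hlam hμ hξ hs)
    (fun s hs => by rw [zero_mul, add_zero]; exact h.stateMean_cast_eq hα hlam hμ hξ hs) ht,
    tsum_pow_mul_fracIntegral hp hα ht, zero_mul, add_zero]

theorem stateMean_sq (h : SolvesForward Q X α lam μ ξ i) (hα : 0 < α)
    (hlam : 0 ≤ lam) (hμ : 0 ≤ μ) (hξ : 0 ≤ ξ) {t : ℝ} (ht : 0 ≤ t) :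
    stateMean Q X (fun n => (n : ℝ) ^ 2) t = (i : ℝ) ^ 2 * mittagLeffler 1 α 1 (-ξ * t ^ α)
      + (lam + μ) * (t ^ α * mittagLeffler 1 α (α + 1) (-ξ * t ^ α))
      + -μ * mlConv α ξ 1 (stateProb Q X 0) t
      + 2 * (lam - μ) * (i * (t ^ α * mittagLeffler 2 α (α + 1) (-ξ * t ^ α))
        + (lam - μ) * (t ^ (2 * α) * mittagLeffler 2 α (2 * α + 1) (-ξ * t ^ α))
        + μ * mlConv α ξ 2 (stateProb Q X 0) t) := by
  have hp := MeasurableLocallyBounded.of_continuous (h.continuous 0)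
  have hm1 := h.measurableLocallyBounded_stateMean hα hlam hμ hξ zero_le_one abs_cast_le
  have hm2 := h.measurableLocallyBounded_stateMean hα hlam hμ hξ zero_le_one abs_cast_sq_le
  rw [eq_tsum_of_eq_add_fracIntegral hm2 hm1
    (hp.const_add_fracIntegral hα.le ((i : ℝ) ^ 2) (lam + μ) (-μ))
    (hp.const_add_fracIntegral hα.le i (lam - μ) μ) hα
    (fun s hs => h.stateMean_cast_eq hα hlam hμ hξ hs)
    (fun s hs => h.stateMean_sq_eq hα hlam hμ hξ hs) ht,
    tsum_pow_mul_fracIntegral hp hα ht, tsum_succ_mul_pow_mul_fracIntegral hp hα ht]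

theorem memLp_two (h : SolvesForward Q X α lam μ ξ i) (hα : 0 < α)
    (hlam : 0 ≤ lam) (hμ : 0 ≤ μ) (hξ : 0 ≤ ξ) (t : ℝ≥0) :
    MemLp (fun ω => (X t ω : ℝ)) 2 Q :=
  (memLp_two_iff_integrable_sq
    (h.measurable_comp (fun n => (n : ℝ)) t).aestronglyMeasurable).2
    (h.integrable_sq hα hlam hμ hξ t)

end SolvesForward

theorem mainTheorem4 {Ω : Type*} [MeasurableSpace Ω] (P : Measure Ω) [IsProbabilityMeasure P]
    (α lam μ ξ : ℝ) (hα0 : 0 < α) (hα1 : α ≤ 1) (hlam : 0 < lam) (hμ : 0 < μ) (hξ : 0 ≤ ξ)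
    (X : ℝ≥0 → Ω → ℕ) (hX : IsFractionalQueue P α lam μ ξ X)
    (i : ℕ) (hi : P (X 0 ⁻¹' {i}) ≠ 0) (t : ℝ≥0) :
    MemLp (fun ω => (X t ω : ℝ)) 2 (cond P (X 0 ⁻¹' {i})) ∧
    (0 < ξ →
      variance (fun ω => (X t ω : ℝ)) (cond P (X 0 ⁻¹' {i})) =
        (i : ℝ) ^ 2 * mittagLeffler 1 α 1 (-ξ * (t : ℝ) ^ α)
          + 2 * i * (t : ℝ) ^ α * (lam - μ) * mittagLeffler 2 α (α + 1) (-ξ * (t : ℝ) ^ α)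
          - μ * mlConv α ξ 1 (transitionProb P X i 0) t
          + 2 * μ * (lam - μ) * mlConv α ξ 2 (transitionProb P X i 0) t
          + (μ + lam) * (t : ℝ) ^ α * mittagLeffler 1 α (α + 1) (-ξ * (t : ℝ) ^ α)
          + 2 * (t : ℝ) ^ (2 * α) * (lam - μ) ^ 2
              * mittagLeffler 2 α (2 * α + 1) (-ξ * (t : ℝ) ^ α)
          - (i * mittagLeffler 1 α 1 (-ξ * (t : ℝ) ^ α)
              + μ * mlConv α ξ 1 (transitionProb P X i 0) t
              + (lam - μ) / ξ * (1 - mittagLeffler 1 α 1 (-ξ * (t : ℝ) ^ α))) ^ 2) ∧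
    variance (fun ω => (X t ω : ℝ)) (cond P (X 0 ⁻¹' {i})) =
        (i : ℝ) ^ 2 * mittagLeffler 1 α 1 (-ξ * (t : ℝ) ^ α)
          + 2 * i * (t : ℝ) ^ α * (lam - μ) * mittagLeffler 2 α (α + 1) (-ξ * (t : ℝ) ^ α)
          - μ * mlConv α ξ 1 (transitionProb P X i 0) t
          + 2 * μ * (lam - μ) * mlConv α ξ 2 (transitionProb P X i 0) t
          + (μ + lam) * (t : ℝ) ^ α * mittagLeffler 1 α (α + 1) (-ξ * (t : ℝ) ^ α)
          + 2 * (t : ℝ) ^ (2 * α) * (lam - μ) ^ 2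
              * mittagLeffler 2 α (2 * α + 1) (-ξ * (t : ℝ) ^ α)
          - (i * mittagLeffler 1 α 1 (-ξ * (t : ℝ) ^ α)
              + μ * mlConv α ξ 1 (transitionProb P X i 0) t
              + (lam - μ) * (t : ℝ) ^ α * mittagLeffler 1 α (α + 1) (-ξ * (t : ℝ) ^ α)) ^ 2 := by
  have : IsProbabilityMeasure (cond P (X 0 ⁻¹' {i})) := cond_isProbabilityMeasure hi
  have h := hX.solvesForward hα0 hα1 hi
  have hmem := h.memLp_two hα0 hlam.le hμ.le hξ t
  have hp : stateProb (cond P (X 0 ⁻¹' {i})) X 0 = transitionProb P X i 0 := rfl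
  have h1 := h.stateMean_cast hα0 hlam.le hμ.le hξ t.coe_nonneg
  have h2 := h.stateMean_sq hα0 hlam.le hμ.le hξ t.coe_nonneg
  simp only [stateMean, Real.toNNReal_coe, hp] at h1 h2
  have hvar := variance_eq_sub hmem
  simp only [Pi.pow_apply] at hvar
  rw [h1, h2] at hvar
  refine ⟨hmem, fun hξ0 => ?_, ?_⟩
  · have hmain : (lam - μ) / ξ * (1 - mittagLeffler 1 α 1 (-ξ * (t : ℝ) ^ α))
        = (lam - μ) * ((t : ℝ) ^ α * mittagLeffler 1 α (α + 1) (-ξ * (t : ℝ) ^ α)) := by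
      rw [one_add_mul_mittagLeffler_one hα0]
      field_simp
      ring
    rw [hvar, hmain]
    ring
  · rw [hvar]
    ring
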